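/- For a finite group $G$ and integers $x_g$ ($g\in G$) let $\mathscr{D}_G(x)=\det\left(x_{gh^{-1}}\right)_{g,h\in G}$ be the group determinant, and let $$\lambda(G)=\min\{|\mathscr{D}_G(x)|\ge 2 : x\in\mathbb Z^{G}\}$$ be the smallest nontrivial absolute value of an integer group determinant of $G$. Let $n\ge 1$ and let $D_{2n}$ be the dihedral group of order $2n$. Then $$\lambda(D_{2n})=\begin{cases} 3, & \text{if } 3\nmid n,\\ 4, & \text{if } n=3m,\ 2\nmid m,\\ 5, & \text{if } n=2\cdot 3\, m,\ 5\nmid m,\\ 7, & \text{if } n=2\cdot 3\cdot 5\, m,\ 7\nmid m,\\ 11, & \text{if } n=2\cdot 3\cdot 5\cdot 7\, m,\ 11\nmid m,\\ 13, & \text{if } n=2\cdot 3\cdot 5\cdot 7\cdot 11\, m,\ 13\nmid m,\\ 16, & \text{if } n=2\cdot 3\cdot 5\cdot 7\cdot 11\cdot 13\, m,\ 2\nmid m,\\ 17, & \text{if } n=2^2\cdot 3\cdot 5\cdot 7\cdot 11\cdot 13\, m,\ 17\nmid m,\\ 19, & \text{if } n=2^2\cdot 3\cdot 5\cdot 7\cdot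 11\cdot 13\cdot 17\, m,\ 19\nmid m,\\ 23, & \text{if } n=2^2\cdot 3\cdot 5\cdot 7\cdot 11\cdot 13\cdot 17\cdot 19\, m,\ 23\nmid m,\\ 27, & \text{if } n=2^2\cdot 3\cdot 5\cdot 7\cdot 11\cdot 13\cdot 17\cdot 19\cdot 23\, m,\ 3\nmid m,\\ 29, & \text{if } n=2^2\cdot 3^2\cdot 5\cdot 7\cdot 11\cdot 13\cdot 17\cdot 19\cdot 23\, m,\ 29\nmid m, \end{cases}$$ and, for every prime $p$ with $31\le p\le 113$, $$\lambda(D_{2n})=p\quad\text{if } n=2^2\cdot 3^2\cdot\Big(\prod_{\substack{q\text{ prime}\\ 5\le q<p}}q\Big)\cdot m,\ p\nmid m.$$ Every $n\ge 1$ that is not divisible by $2^2\cdot 3^2\cdot\prod_{5\le q\le 113,\ q\text{ prime}}q$ falls under one of these cases. -/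

import Mathlib

/-- The group determinant of a finite group `G` at `x`: the determinant of the matrix with rows and
columns indexed by `G` and with entry `x (g * h⁻¹)` at `(g, h)`. -/
def groupDet {G R : Type*} [Group G] [Fintype G] [DecidableEq G] [CommRing R] (x : G → R) : R :=
  (Matrix.of fun g h : G => x (g * h⁻¹)).det

/-- The absolute values, at least `2`, of the integer group determinants of `G`. -/
def nontrivialDetValues (G : Type*) [Group G] [Fintype G] [DecidableEq G] : Set ℕ :=
  {v | 2 ≤ v ∧ ∃ x : G → ℤ, (groupDet x).natAbs = v}

/-- `x = 2` at the identity and `0` elsewhere has group determinant `2 ^ |G|`, so there always is a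
nontrivial value. -/
theorem nontrivialDetValues_nonempty (G : Type*) [Group G] [Fintype G] [DecidableEq G] :
    (nontrivialDetValues G).Nonempty := by
  refine ⟨2 ^ Fintype.card G, ?_, fun g => if g = 1 then 2 else 0, ?_⟩
  · exact Nat.le_self_pow Fintype.card_ne_zero 2
  · have h : (Matrix.of fun g h : G => if g * h⁻¹ = 1 then (2 : ℤ) else 0) =
        Matrix.diagonal fun _ => 2 := by
      ext g h
      simp [Matrix.diagonal_apply, mul_inv_eq_one]
    simp [groupDet, h, Int.natAbs_pow]

/-- `λ(G)`: the smallest absolute value, at least `2`, of an integer group determinant of `G`. -/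
noncomputable def lindLehmer (G : Type*) [Group G] [Fintype G] [DecidableEq G] : ℕ :=
  sInf (nontrivialDetValues G)

/-- The minimum defining `λ(G)` is attained: `λ(G)` is the least nontrivial value. -/
theorem lindLehmer_isLeast (G : Type*) [Group G] [Fintype G] [DecidableEq G] :
    IsLeast (nontrivialDetValues G) (lindLehmer G) :=
  ⟨Nat.sInf_mem (nontrivialDetValues_nonempty G), fun _ h => Nat.sInf_le h⟩

/-- The product of the primes `q` with `5 ≤ q < k`. -/
def primeProd (k : ℕ) : ℕ := ∏ q ∈ (Finset.Ico 5 k).filter Nat.Prime, q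

/-- The table of cases: `n` satisfies a condition for which the value `v` is listed. -/
def DihedralCase (n v : ℕ) : Prop :=
  (v = 3 ∧ ¬ 3 ∣ n) ∨
  (v = 4 ∧ ∃ m, n = 3 * m ∧ ¬ 2 ∣ m) ∨
  (v = 5 ∧ ∃ m, n = 2 * 3 * m ∧ ¬ 5 ∣ m) ∨
  (v = 7 ∧ ∃ m, n = 2 * 3 * 5 * m ∧ ¬ 7 ∣ m) ∨
  (v = 11 ∧ ∃ m, n = 2 * 3 * 5 * 7 * m ∧ ¬ 11 ∣ m) ∨
  (v = 13 ∧ ∃ m, n = 2 * 3 * 5 * 7 * 11 * m ∧ ¬ 13 ∣ m) ∨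
  (v = 16 ∧ ∃ m, n = 2 * 3 * 5 * 7 * 11 * 13 * m ∧ ¬ 2 ∣ m) ∨
  (v = 17 ∧ ∃ m, n = 2 ^ 2 * 3 * 5 * 7 * 11 * 13 * m ∧ ¬ 17 ∣ m) ∨
  (v = 19 ∧ ∃ m, n = 2 ^ 2 * 3 * 5 * 7 * 11 * 13 * 17 * m ∧ ¬ 19 ∣ m) ∨
  (v = 23 ∧ ∃ m, n = 2 ^ 2 * 3 * 5 * 7 * 11 * 13 * 17 * 19 * m ∧ ¬ 23 ∣ m) ∨
  (v = 27 ∧ ∃ m, n = 2 ^ 2 * 3 * 5 * 7 * 11 * 13 * 17 * 19 * 23 * m ∧ ¬ 3 ∣ m) ∨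
  (v = 29 ∧ ∃ m, n = 2 ^ 2 * 3 ^ 2 * 5 * 7 * 11 * 13 * 17 * 19 * 23 * m ∧ ¬ 29 ∣ m) ∨
  (Nat.Prime v ∧ 31 ≤ v ∧ v ≤ 113 ∧ ∃ m, n = 2 ^ 2 * 3 ^ 2 * primeProd v * m ∧ ¬ v ∣ m)

/-! A Fourier transform on the rotations turns the determinant into the product over `z ^ n = 1` of
`f(z) f(z⁻¹) - g(z) g(z⁻¹)`, with integer polynomials `f`, `g` carrying the rotation and reflection
coefficients. Each factor is symmetric in `z` and `z⁻¹`, hence equals `h(z + z⁻¹)` for an integer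
polynomial `h`, and the determinant is the resultant of `C_n - 2` with `h`, where `C_n(z + z⁻¹) =
z^n + z⁻ⁿ`.

Lower bounds come from factoring `C_n - 2`. For an odd prime `p = 2k+1`, `C_{pm} - 2 = (C_m - 2)
V_k(C_m)²`, and modulo `p` both `C_m - 2` and `V_k(C_m)` have the same irreducible factors. So a
determinant divisible by `p` gains `p²` for each factor `p` of `n`: if `p^a ∣ n`, then `p^(2a+1)`
divides it (`odd_prime_pow_dvd_resultant`). An even determinant is divisible by `4`, by `16` if `2 ∣
n`, and by `256` if `4 ∣ n` (`dvd_groupDet_dihedral_of_even`). The last bound combines the dihedral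
group of order `8` with a study of the factors `V`, `W`, `U` coming from the odd part of `n`.

If `q` is the least prime factor of a nontrivial value `u`, then either `q ≥ v` or these
divisibilities force `u ≥ v` (`lindLehmer_dihedral_eq`). The values `v` are attained explicitly: odd
`v` prime to `n` by geometric sums, and `4`, `16`, `27` by `1 + X`, `1 + X²` and the pair `1 + X³`,
`1`. -/

/-! ### Factorisations of rescaled Chebyshev polynomials -/

section ChebyshevFactors

open Polynomial

theorem natDegree_chebyshevS_and_monic {R : Type*} [CommRing R] [Nontrivial R] (n : ℕ) :
    (Chebyshev.S R n).natDegree = n ∧ (Chebyshev.S R n).Monic := by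
  induction n using Nat.twoStepInduction with
  | zero => simp [monic_one]
  | one => simp [monic_X]
  | more n ih0 ih1 =>
    have key : Chebyshev.S R ((n + 2 : ℕ) : ℤ) =
        X * Chebyshev.S R ((n + 1 : ℕ) : ℤ) - Chebyshev.S R (n : ℤ) := by
      push_cast; exact Chebyshev.S_add_two R n
    have hm : (X * Chebyshev.S R ((n + 1 : ℕ) : ℤ)).Monic := monic_X.mul ih1.2
    have hd : (X * Chebyshev.S R ((n + 1 : ℕ) : ℤ)).natDegree = n + 2 := by
      rw [monic_X.natDegree_mul ih1.2, ih1.1, natDegree_X]; ring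
    have hlt : (Chebyshev.S R (n : ℤ)).natDegree <
        (X * Chebyshev.S R ((n + 1 : ℕ) : ℤ)).natDegree := by
      rw [hd, ih0.1]; omega
    rw [key]
    exact ⟨by rw [natDegree_sub_eq_left_of_natDegree_lt hlt, hd],
      hm.sub_of_left (degree_lt_degree hlt)⟩

theorem monic_chebyshevS_add_mul {R : Type*} [CommRing R] [Nontrivial R] (k : ℕ) (c : R) :
    (Chebyshev.S R k + C c * Chebyshev.S R (k - 1 : ℤ)).Monic := by
  cases k with
  | zero => simp [monic_one]
  | succ k =>
    have h1 := natDegree_chebyshevS_and_monic (R := R) (k + 1)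
    have h0 := natDegree_chebyshevS_and_monic (R := R) k
    push_cast at h1 ⊢
    rw [add_sub_cancel_right]
    refine h1.2.add_of_left ?_
    refine lt_of_le_of_lt ?_ (degree_lt_degree (p := Chebyshev.S R k) (by rw [h0.1, h1.1]; omega))
    rw [← smul_eq_C_mul]
    exact degree_smul_le _ _

/-- The factor `S_k + S_{k-1}`, whose square is `(C_{2k+1} - 2) / (X - 2)`. -/
noncomputable def chebyshevV (k : ℕ) : ℤ[X] := Chebyshev.S ℤ k + Chebyshev.S ℤ (k - 1 : ℤ)

/-- The factor `S_k - S_{k-1}`, whose square is `(C_{2k+1} + 2) / (X + 2)`. -/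
noncomputable def chebyshevW (k : ℕ) : ℤ[X] := Chebyshev.S ℤ k - Chebyshev.S ℤ (k - 1 : ℤ)

theorem monic_chebyshevV (k : ℕ) : (chebyshevV k).Monic := by
  simpa [chebyshevV] using monic_chebyshevS_add_mul k (1 : ℤ)

theorem monic_chebyshevW (k : ℕ) : (chebyshevW k).Monic := by
  simpa [chebyshevW, sub_eq_add_neg] using monic_chebyshevS_add_mul k (-1 : ℤ)

/-- This is `C_{k+1} C_k = C_{2k+1} + C_1` with both factors on the left rewritten through `S_k` and
`S_{k-1}`. -/
theorem chebyshevC_odd_eq (k : ℤ) :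
    Chebyshev.C ℤ (2 * k + 1) = (2 * Chebyshev.S ℤ k - X * Chebyshev.S ℤ (k - 1)) *
      (X * Chebyshev.S ℤ k - 2 * Chebyshev.S ℤ (k - 1)) - X := by
  have h1 := Chebyshev.C_eq_S_sub_X_mul_S ℤ k
  have h2 := Chebyshev.C_eq_S_sub_X_mul_S ℤ (k + 1)
  have h3 := Chebyshev.S_add_one ℤ k
  have h4 := Chebyshev.C_mul_C ℤ (k + 1) k
  rw [show k + 1 + k = 2 * k + 1 by ring, show k + 1 - k = 1 by ring, Chebyshev.C_one, h1, h2,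
    h3, add_sub_cancel_right] at h4
  linear_combination -h4

theorem chebyshevC_odd_sub_two (k : ℕ) :
    Chebyshev.C ℤ (2 * k + 1 : ℤ) - 2 = (X - 2) * chebyshevV k ^ 2 := by
  -- The relation `S_k² + S_{k-1}² - X S_k S_{k-1} = 1` makes the constant `2` a quadratic form in
  -- `S_k`, `S_{k-1}`.
  have h := Chebyshev.S_sq_add_S_sq ℤ ((k : ℤ) - 1)
  rw [sub_add_cancel] at h
  rw [chebyshevC_odd_eq, chebyshevV]
  linear_combination (X + 2) * h

theorem chebyshevC_odd_add_two (k : ℕ) :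
    Chebyshev.C ℤ (2 * k + 1 : ℤ) + 2 = (X + 2) * chebyshevW k ^ 2 := by
  have h := Chebyshev.S_sq_add_S_sq ℤ ((k : ℤ) - 1)
  rw [sub_add_cancel] at h
  rw [chebyshevC_odd_eq, chebyshevW]
  linear_combination (X - 2) * h

theorem X_dvd_chebyshevC_odd (k : ℕ) : X ∣ Chebyshev.C ℤ (2 * k + 1 : ℤ) := by
  induction k with
  | zero => simp
  | succ k ih =>
    have h := Chebyshev.C_add_two ℤ (2 * k + 1 : ℤ)
    rw [show 2 * ((k + 1 : ℕ) : ℤ) + 1 = 2 * k + 1 + 2 by push_cast; ring, h]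
    exact dvd_sub (dvd_mul_right _ _) ih

theorem chebyshevC_two_mul (n : ℤ) : Chebyshev.C ℤ (2 * n) = Chebyshev.C ℤ n ^ 2 - 2 := by
  rw [Chebyshev.C_mul, Chebyshev.C_two]; simp

theorem natDegree_chebyshevC_and_monic (n : ℕ) :
    (Chebyshev.C ℤ ((n + 1 : ℕ) : ℤ)).natDegree = n + 1 ∧
      (Chebyshev.C ℤ ((n + 1 : ℕ) : ℤ)).Monic := by
  cases n with
  | zero => simp [monic_X]
  | succ n =>
    have h1 := natDegree_chebyshevS_and_monic (R := ℤ) (n + 2)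
    have h0 := natDegree_chebyshevS_and_monic (R := ℤ) n
    have key : Chebyshev.C ℤ ((n + 1 + 1 : ℕ) : ℤ) =
        Chebyshev.S ℤ ((n + 2 : ℕ) : ℤ) - Chebyshev.S ℤ (n : ℤ) := by
      have h2 := Chebyshev.C_eq_S_sub_X_mul_S ℤ (n + 2 : ℤ)
      have h3 := Chebyshev.S_add_two ℤ (n : ℤ)
      push_cast
      rw [show (n : ℤ) + 2 - 1 = n + 1 by ring] at h2
      rw [show (n : ℤ) + 1 + 1 = n + 2 by ring, h2]
      linear_combination h3
    have hlt : (Chebyshev.S ℤ (n : ℤ)).natDegree <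
        (Chebyshev.S ℤ ((n + 2 : ℕ) : ℤ)).natDegree := by rw [h0.1, h1.1]; omega
    rw [key]
    exact ⟨by rw [natDegree_sub_eq_left_of_natDegree_lt hlt, h1.1],
      h1.2.sub_of_left (degree_lt_degree hlt)⟩

theorem monic_chebyshevC {n : ℕ} (hn : n ≠ 0) : (Chebyshev.C ℤ (n : ℤ)).Monic := by
  obtain ⟨k, rfl⟩ := Nat.exists_eq_succ_of_ne_zero hn
  exact (natDegree_chebyshevC_and_monic k).2

theorem natDegree_chebyshevC {n : ℕ} (hn : n ≠ 0) : (Chebyshev.C ℤ (n : ℤ)).natDegree = n := by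
  obtain ⟨k, rfl⟩ := Nat.exists_eq_succ_of_ne_zero hn
  exact (natDegree_chebyshevC_and_monic k).1

theorem monic_chebyshevC_add_C {n : ℕ} (hn : n ≠ 0) (c : ℤ) :
    (Chebyshev.C ℤ (n : ℤ) + C c).Monic := by
  refine (monic_chebyshevC hn).add_of_left (degree_C_le.trans_lt ?_)
  rw [degree_eq_natDegree (monic_chebyshevC hn).ne_zero, natDegree_chebyshevC hn]
  exact_mod_cast Nat.pos_of_ne_zero hn

theorem monic_chebyshevC_sub_two {n : ℕ} (hn : n ≠ 0) : (Chebyshev.C ℤ (n : ℤ) - 2).Monic := by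
  have := monic_chebyshevC_add_C hn (-2)
  rwa [show (C (-2) : ℤ[X]) = -2 by rw [C_neg]; rfl, ← sub_eq_add_neg] at this

theorem chebyshevC_map_prime (p : ℕ) [Fact p.Prime] : Chebyshev.C (ZMod p) (p : ℤ) = X ^ p := by
  rw [← dickson_one_one_eq_chebyshev_C, dickson_one_one_zmod_p]

theorem chebyshevC_eval_add_inv {K : Type*} [Field K] {z : K} (hz : z ≠ 0) (n : ℕ) :
    (Chebyshev.C K (n : ℤ)).eval (z + z⁻¹) = z ^ n + z⁻¹ ^ n := by
  rw [← dickson_one_one_eq_chebyshev_C, dickson_one_one_eval_add_inv _ _ (mul_inv_cancel₀ hz)]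

end ChebyshevFactors

/-! ### Resultants with a monic integer polynomial -/

section Resultant

open Polynomial

theorem resultant_mul_of_monic {P Q : ℤ[X]} (hP : P.Monic) (hQ : Q.Monic) (h : ℤ[X]) :
    (P * Q).resultant h = P.resultant h * Q.resultant h := by
  rw [hP.natDegree_mul hQ, resultant_mul_left _ _ _ _ le_rfl]

theorem resultant_sq_of_monic {P : ℤ[X]} (hP : P.Monic) (h : ℤ[X]) :
    (P ^ 2).resultant h = P.resultant h ^ 2 := by
  rw [sq, resultant_mul_of_monic hP hP, sq]

theorem resultant_X_sub_C_eq_eval (h : ℤ[X]) (r : ℤ) : (X - C r).resultant h = h.eval r := by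
  rw [natDegree_X_sub_C, resultant_X_sub_C_left _ _ _ le_rfl]

/-- The image of `h` may have smaller degree; the correction is a power of the leading coefficient
of `P`, which is `1`. -/
theorem resultant_map_eq {K : Type*} [Field K] (φ : ℤ →+* K) {P : ℤ[X]} (hP : P.Monic)
    (h : ℤ[X]) : φ (P.resultant h) = (P.map φ).resultant (h.map φ) := by
  obtain ⟨k, hk⟩ := Nat.exists_eq_add_of_le (natDegree_map_le (f := φ) (p := h))
  rw [← resultant_map_map, hk, resultant_add_right_deg _ _ _ _ k le_rfl, hP.natDegree_map,
    ← hP.natDegree_map φ, (hP.map φ).coeff_natDegree, one_pow, one_mul]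

/-- Coprimality over `ZMod p` depends only on irreducible factors, so powers in a factorisation
modulo `p` can be dropped. -/
theorem dvd_resultant_iff {p : ℕ} [Fact p.Prime] {P : ℤ[X]} (hP : P.Monic) (h : ℤ[X]) :
    (p : ℤ) ∣ P.resultant h ↔
      ¬ IsCoprime (P.map (Int.castRingHom (ZMod p))) (h.map (Int.castRingHom (ZMod p))) := by
  rw [← ZMod.intCast_zmod_eq_zero_iff_dvd, ← eq_intCast (Int.castRingHom (ZMod p)),
    resultant_map_eq _ hP, resultant_eq_zero_iff]
  simp [(hP.map (Int.castRingHom (ZMod p))).ne_zero]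

end Resultant

/-! ### The group determinant as a product over roots of unity -/

section FourierFactorisation

open Polynomial Matrix

/-- The enumeration of the dihedral group by a reflection bit and a residue. -/
def dihedralEquiv (n : ℕ) : Fin 2 × ZMod n ≃ DihedralGroup n where
  toFun p := if p.1 = 0 then .r p.2 else .sr p.2
  invFun
    | .r i => (0, i)
    | .sr i => (1, i)
  left_inv := by rintro ⟨s, i⟩; fin_cases s <;> rfl
  right_inv := by rintro (i | i) <;> rfl

theorem det_addChar_ne_zero (n : ℕ) [NeZero n] :
    (Matrix.of fun k i : ZMod n => (ZMod.stdAddChar (k * i) : ℂ)).det ≠ 0 := by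
  have h : (Matrix.of fun k i : ZMod n => (ZMod.stdAddChar (k * i) : ℂ)) *
      (Matrix.of fun i k : ZMod n => (ZMod.stdAddChar (-(i * k)) : ℂ)) = (n : ℂ) • 1 := by
    ext k l
    simp only [mul_apply, of_apply, ← AddChar.map_add_eq_mul]
    have := AddChar.sum_mulShift (k - l) (ZMod.isPrimitive_stdAddChar n)
    simp only [sub_eq_zero, ZMod.card] at this
    rw [Matrix.smul_apply, one_apply, smul_eq_mul, mul_ite, mul_one, mul_zero]
    convert this using 3
    · ring
    · split_ifs <;> simp
  intro h0
  have h2 := congrArg Matrix.det h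
  rw [det_mul, h0, zero_mul, det_smul, det_one, mul_one] at h2
  exact (pow_ne_zero _ (Nat.cast_ne_zero.mpr (NeZero.ne n))) h2.symm

/-- The Fourier matrix, applied on each of the two cosets of the rotations, conjugates the group
matrix into `2 × 2` blocks `B k`, one for each character of the rotations. The factors are the block
determinants. -/
theorem groupDet_eq_prod_fourier (n : ℕ) [NeZero n] (x : DihedralGroup n → ℂ) :
    groupDet x = ∏ k : ZMod n,
      ((∑ i, x (.r i) * ZMod.stdAddChar (k * i)) * (∑ i, x (.r i) * ZMod.stdAddChar (-(k * i))) -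
        (∑ i, x (.sr i) * ZMod.stdAddChar (k * i)) *
          (∑ i, x (.sr i) * ZMod.stdAddChar (-(k * i)))) := by
  let a (k : ZMod n) : ℂ := ∑ i, x (.r i) * ZMod.stdAddChar (k * i)
  let b (k : ZMod n) : ℂ := ∑ i, x (.sr i) * ZMod.stdAddChar (k * i)
  let V : Matrix (ZMod n) (ZMod n) ℂ := .of fun k i => ZMod.stdAddChar (k * i)
  let W : Matrix (Fin 2 × ZMod n) (Fin 2 × ZMod n) ℂ := kroneckerMap (· * ·) 1 V
  let M : Matrix (DihedralGroup n) (DihedralGroup n) ℂ := .of fun g h => x (g * h⁻¹)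
  let B (k : ZMod n) : Matrix (Fin 2) (Fin 2) ℂ := !![a k, b (-k); b k, a (-k)]
  have hW : W.det ≠ 0 := by
    rw [show W.det = _ from det_kronecker _ _, det_one, one_pow, one_mul]
    exact pow_ne_zero _ (det_addChar_ne_zero n)
  have hleft (u : ZMod n → ℂ) (k j : ZMod n) :
      ∑ i, ZMod.stdAddChar (k * i) * u (i - j) =
        (∑ i, u i * ZMod.stdAddChar (k * i)) * ZMod.stdAddChar (k * j) := by
    rw [← Equiv.sum_comp (Equiv.addRight j), Finset.sum_mul]
    refine Finset.sum_congr rfl fun i _ => ?_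
    rw [Equiv.coe_addRight, add_sub_cancel_right, mul_add, AddChar.map_add_eq_mul]
    ring
  have hright (u : ZMod n → ℂ) (k j : ZMod n) :
      ∑ i, ZMod.stdAddChar (k * i) * u (j - i) =
        (∑ i, u i * ZMod.stdAddChar (-k * i)) * ZMod.stdAddChar (k * j) := by
    rw [← Equiv.sum_comp (Equiv.subLeft j), Finset.sum_mul]
    refine Finset.sum_congr rfl fun i _ => ?_
    rw [Equiv.subLeft_apply, sub_sub_cancel, mul_sub, sub_eq_add_neg, AddChar.map_add_eq_mul,
      neg_mul]
    ring
  have hconj : W * M.submatrix (dihedralEquiv n) (dihedralEquiv n) = blockDiagonal B * W := by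
    ext ⟨s, k⟩ ⟨t, j⟩
    simp only [mul_apply, Fintype.sum_prod_type, Fin.sum_univ_two, W, V, blockDiagonal_apply,
      kroneckerMap_apply, submatrix_apply, of_apply, M, B, one_apply]
    have h1 := hleft (fun i => x (.r i)) k j
    have h2 := hleft (fun i => x (.sr i)) k j
    have h3 := hright (fun i => x (.r i)) k j
    have h4 := hright (fun i => x (.sr i)) k j
    simp only [neg_mul] at h3 h4
    fin_cases s <;> fin_cases t <;>
      simpa [dihedralEquiv, DihedralGroup.inv_r, DihedralGroup.inv_sr, ← sub_eq_add_neg, a, b]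
  have hdet := congrArg Matrix.det hconj
  rw [det_mul, det_mul, det_submatrix_equiv_self, mul_comm, det_blockDiagonal] at hdet
  rw [show groupDet x = M.det from rfl, mul_right_cancel₀ hW hdet]
  refine Finset.prod_congr rfl fun k _ => ?_
  simp only [B, det_fin_two_of, a, b, neg_mul]
  ring

theorem prod_stdAddChar_eq {M : Type*} [CommMonoid M] (n : ℕ) [NeZero n] (F : ℂ → M) :
    ∏ k : ZMod n, F (ZMod.stdAddChar k) = ∏ z ∈ nthRootsFinset n (1 : ℂ), F z := by
  classical
  rw [← Finset.prod_image (f := F) (g := fun k : ZMod n => (ZMod.stdAddChar k : ℂ))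
    (fun _ _ _ _ h => ZMod.injective_stdAddChar h)]
  refine Finset.prod_congr (Finset.eq_of_subset_of_card_le ?_ ?_) fun _ _ => rfl
  · intro z hz
    obtain ⟨k, -, rfl⟩ := Finset.mem_image.mp hz
    rw [mem_nthRootsFinset (NeZero.pos n), ← AddChar.map_nsmul_eq_pow]
    simp
  · rw [Finset.card_image_of_injective _ ZMod.injective_stdAddChar,
      (Complex.isPrimitiveRoot_exp n (NeZero.ne n)).card_nthRootsFinset]
    simp [ZMod.card]

/-- The polynomial `∑ u i X ^ i`, with exponents the least nonnegative residues. -/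
noncomputable def residuePoly {n : ℕ} [NeZero n] (u : ZMod n → ℤ) : ℤ[X] :=
  ∑ i, C (u i) * X ^ i.val

theorem aeval_residuePoly {n : ℕ} [NeZero n] (u : ZMod n → ℤ) (k : ZMod n) :
    aeval (ZMod.stdAddChar k : ℂ) (residuePoly u) = ∑ i, (u i : ℂ) * ZMod.stdAddChar (k * i) := by
  simp only [residuePoly, map_sum, map_mul, map_pow, aeval_X, eq_intCast, map_intCast]
  refine Finset.sum_congr rfl fun i _ => ?_
  rw [← AddChar.map_nsmul_eq_pow, nsmul_eq_mul, ZMod.natCast_zmod_val, mul_comm i k]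

theorem intCast_groupDet {G : Type*} [Group G] [Fintype G] [DecidableEq G] (x : G → ℤ) :
    ((groupDet x : ℤ) : ℂ) = groupDet fun g => (x g : ℂ) := by
  rw [groupDet, groupDet, ← eq_intCast (Int.castRingHom ℂ), RingHom.map_det]
  rfl

/-- Only values at `n`-th roots of unity matter; this freedom serves both a given `x` and
determinants built from arbitrary polynomials. -/
theorem groupDet_dihedral_eq_prod {n : ℕ} [NeZero n] (x : DihedralGroup n → ℤ) {f g : ℤ[X]}
    (hf : ∀ z : ℂ, z ^ n = 1 → aeval z f = aeval z (residuePoly fun i => x (.r i)))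
    (hg : ∀ z : ℂ, z ^ n = 1 → aeval z g = aeval z (residuePoly fun i => x (.sr i))) :
    ((groupDet x : ℤ) : ℂ) = ∏ z ∈ nthRootsFinset n (1 : ℂ),
      (aeval z f * aeval z⁻¹ f - aeval z g * aeval z⁻¹ g) := by
  rw [intCast_groupDet, groupDet_eq_prod_fourier, ← prod_stdAddChar_eq]
  refine Finset.prod_congr rfl fun k _ => ?_
  have hk (k : ZMod n) : (ZMod.stdAddChar k : ℂ) ^ n = 1 := by
    rw [← AddChar.map_nsmul_eq_pow]; simp
  rw [← AddChar.map_neg_eq_inv, hf _ (hk _), hf _ (hk _), hg _ (hk _), hg _ (hk _)]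
  simp only [aeval_residuePoly, neg_mul]

theorem exists_residuePoly_eq (n : ℕ) [NeZero n] (f : ℤ[X]) :
    ∃ u : ZMod n → ℤ, ∀ z : ℂ, z ^ n = 1 → aeval z f = aeval z (residuePoly u) := by
  induction f using Polynomial.induction_on' with
  | add p q hp hq =>
    obtain ⟨u, hu⟩ := hp
    obtain ⟨v, hv⟩ := hq
    refine ⟨u + v, fun z hz => ?_⟩
    rw [map_add, hu z hz, hv z hz]
    simp [residuePoly, add_mul, Finset.sum_add_distrib]
  | monomial k c =>
    refine ⟨Pi.single (k : ZMod n) c, fun z hz => ?_⟩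
    rw [residuePoly, Finset.sum_eq_single (k : ZMod n) (fun i _ hi => by simp [hi]) (by simp)]
    rw [ZMod.val_natCast, aeval_monomial]
    simp only [Pi.single_eq_same, map_mul, map_pow, aeval_C, aeval_X]
    congr 1
    conv_lhs => rw [← Nat.div_add_mod k n, pow_add, pow_mul, hz, one_pow, one_mul]

/-- Every pair of integer polynomials comes from an element of the integral group ring. -/
theorem exists_groupDet_dihedral_eq (n : ℕ) [NeZero n] (f g : ℤ[X]) :
    ∃ x : DihedralGroup n → ℤ, ((groupDet x : ℤ) : ℂ) = ∏ z ∈ nthRootsFinset n (1 : ℂ),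
      (aeval z f * aeval z⁻¹ f - aeval z g * aeval z⁻¹ g) := by
  obtain ⟨u, hu⟩ := exists_residuePoly_eq n f
  obtain ⟨v, hv⟩ := exists_residuePoly_eq n g
  refine ⟨fun | .r i => u i | .sr i => v i, groupDet_dihedral_eq_prod _ hu hv⟩

end FourierFactorisation

/-! ### Symmetric functions of `z`, `z⁻¹` and the resultant formula -/

section SymmetricForm

open Polynomial

/-- By bilinearity monomials suffice, and there `z^(i-j) + z^(j-i)` is `C_{|i-j|}` at `z + z⁻¹`. -/
theorem exists_eval_add_inv_of_cross (f g : ℤ[X]) :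
    ∃ t : ℤ[X], ∀ z : ℂ, z ≠ 0 →
      aeval z f * aeval z⁻¹ g + aeval z⁻¹ f * aeval z g = aeval (z + z⁻¹) t := by
  induction f using Polynomial.induction_on' with
  | add p q hp hq =>
    obtain ⟨s, hs⟩ := hp
    obtain ⟨t, ht⟩ := hq
    refine ⟨s + t, fun z hz => ?_⟩
    rw [map_add, map_add, map_add, ← hs z hz, ← ht z hz]
    ring
  | monomial i c =>
    induction g using Polynomial.induction_on' with
    | add p q hp hq =>
      obtain ⟨s, hs⟩ := hp
      obtain ⟨t, ht⟩ := hq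
      refine ⟨s + t, fun z hz => ?_⟩
      rw [map_add, map_add, map_add, ← hs z hz, ← ht z hz]
      ring
    | monomial j d =>
      obtain ⟨k, hk⟩ : ∃ k : ℕ, ∀ z : ℂ, z ≠ 0 →
          z ^ i * z⁻¹ ^ j + z⁻¹ ^ i * z ^ j = z ^ k + z⁻¹ ^ k := by
        rcases le_total i j with hij | hij
        · obtain ⟨k, rfl⟩ := Nat.exists_eq_add_of_le hij
          refine ⟨k, fun z hz => ?_⟩
          have hi : z ^ i * z⁻¹ ^ i = 1 := by rw [← mul_pow, mul_inv_cancel₀ hz, one_pow]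
          rw [pow_add, pow_add]
          linear_combination (z ^ k + z⁻¹ ^ k) * hi
        · obtain ⟨k, rfl⟩ := Nat.exists_eq_add_of_le hij
          refine ⟨k, fun z hz => ?_⟩
          have hi : z ^ j * z⁻¹ ^ j = 1 := by rw [← mul_pow, mul_inv_cancel₀ hz, one_pow]
          rw [pow_add, pow_add]
          linear_combination (z ^ k + z⁻¹ ^ k) * hi
      refine ⟨C (c * d) * Chebyshev.C ℤ (k : ℤ), fun z hz => ?_⟩
      rw [map_mul, Chebyshev.aeval_C, chebyshevC_eval_add_inv hz, ← hk z hz]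
      simp only [aeval_monomial, eq_intCast, map_mul, map_intCast]
      ring

theorem exists_eval_add_inv_of_mul (f : ℤ[X]) :
    ∃ t : ℤ[X], ∀ z : ℂ, z ≠ 0 → aeval z f * aeval z⁻¹ f = aeval (z + z⁻¹) t := by
  induction f using Polynomial.induction_on' with
  | add p q hp hq =>
    obtain ⟨s, hs⟩ := hp
    obtain ⟨t, ht⟩ := hq
    obtain ⟨u, hu⟩ := exists_eval_add_inv_of_cross p q
    refine ⟨s + t + u, fun z hz => ?_⟩
    simp only [map_add]
    rw [← hs z hz, ← ht z hz, ← hu z hz]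
    ring
  | monomial i c =>
    refine ⟨C (c * c), fun z hz => ?_⟩
    have hi : z ^ i * z⁻¹ ^ i = 1 := by rw [← mul_pow, mul_inv_cancel₀ hz, one_pow]
    simp only [aeval_monomial, eq_intCast, map_mul, map_intCast]
    linear_combination (c : ℂ) * c * hi

theorem prod_sub_nthRoots {n : ℕ} (hn : 0 < n) (c : ℂ) :
    ∏ z ∈ nthRootsFinset n (1 : ℂ), (c - z) = c ^ n - 1 := by
  have := X_pow_sub_one_eq_prod hn (Complex.isPrimitiveRoot_exp n hn.ne')
  simpa [eval_prod] using (congrArg (eval c) this).symm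

theorem prod_nthRoots_inv {n : ℕ} (hn : 0 < n) {M : Type*} [CommMonoid M] (F : ℂ → M) :
    ∏ z ∈ nthRootsFinset n (1 : ℂ), F z⁻¹ = ∏ z ∈ nthRootsFinset n (1 : ℂ), F z := by
  refine Finset.prod_nbij' (·⁻¹) (·⁻¹) ?_ ?_ ?_ ?_ ?_ <;>
    simp +contextual [mem_nthRootsFinset hn]

/-- Every complex number is `w + w⁻¹`; there both sides equal `(w^n - 1)² / w^n`, since `w + w⁻¹ - z
- z⁻¹ = (w - z)(w - z⁻¹) w⁻¹`. -/
theorem chebyshevC_sub_two_eq_prod {n : ℕ} (hn : 0 < n) :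
    Chebyshev.C ℂ (n : ℤ) - 2 = ∏ z ∈ nthRootsFinset n (1 : ℂ), (X - C (z + z⁻¹)) := by
  refine Polynomial.funext fun y => ?_
  obtain ⟨w, hw, rfl⟩ : ∃ w : ℂ, w ≠ 0 ∧ w + w⁻¹ = y := by
    obtain ⟨w, hw⟩ := IsAlgClosed.exists_root (X ^ 2 - C y * X + 1 : ℂ[X]) (by
      rw [show (X ^ 2 - C y * X + 1 : ℂ[X]) = C 1 * X ^ 2 + C (-y) * X + C 1 by simp; ring,
        degree_quadratic one_ne_zero]
      norm_num)
    have hw' : w ^ 2 - y * w + 1 = 0 := by simpa using hw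
    have hw0 : w ≠ 0 := by rintro rfl; simp at hw'
    exact ⟨w, hw0, by field_simp; linear_combination hw'⟩
  have h1 (z : ℂ) (hz : z ∈ nthRootsFinset n (1 : ℂ)) :
      w + w⁻¹ - (z + z⁻¹) = (w - z) * ((w - z⁻¹) * w⁻¹) := by
    have hz0 : z ≠ 0 := by
      rintro rfl; simp [mem_nthRootsFinset hn, hn.ne'] at hz
    field_simp; ring
  have hcard : (nthRootsFinset n (1 : ℂ)).card = n :=
    (Complex.isPrimitiveRoot_exp n hn.ne').card_nthRootsFinset
  simp only [eval_sub, eval_prod, eval_X, eval_C, chebyshevC_eval_add_inv hw]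
  rw [Finset.prod_congr rfl h1, Finset.prod_mul_distrib, Finset.prod_mul_distrib,
    prod_nthRoots_inv hn (fun z => w - z), prod_sub_nthRoots hn, Finset.prod_const, hcard]
  simp only [eval_ofNat]
  have : w ^ n * w⁻¹ ^ n = 1 := by rw [← mul_pow, mul_inv_cancel₀ hw, one_pow]
  linear_combination (2 - w ^ n) * this

/-- A product over roots of unity of a function of `z + z⁻¹` as a resultant. -/
theorem resultant_chebyshevC_sub_two {n : ℕ} (hn : 0 < n) (h : ℤ[X]) :
    (((Chebyshev.C ℤ (n : ℤ) - 2).resultant h : ℤ) : ℂ) =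
      ∏ z ∈ nthRootsFinset n (1 : ℂ), aeval (z + z⁻¹) h := by
  rw [← eq_intCast (Int.castRingHom ℂ), resultant_map_eq _ (monic_chebyshevC_sub_two hn.ne'),
    Polynomial.map_sub, Chebyshev.map_C, Polynomial.map_ofNat, chebyshevC_sub_two_eq_prod hn,
    resultant_prod_left _ _ _ _
      (by simp only [leadingCoeff_X_sub_C, Finset.prod_const_one, ne_eq, one_ne_zero,
        not_false_eq_true]) le_rfl]
  refine Finset.prod_congr rfl fun z _ => ?_
  rw [natDegree_X_sub_C, resultant_X_sub_C_left _ _ _ le_rfl, eval_map, aeval_def]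
  rfl

theorem exists_groupDet_dihedral_eq_resultant {n : ℕ} [NeZero n] (x : DihedralGroup n → ℤ) :
    ∃ f g h : ℤ[X], (groupDet x = (Chebyshev.C ℤ (n : ℤ) - 2).resultant h) ∧
      ∀ z : ℂ, z ≠ 0 →
        aeval z f * aeval z⁻¹ f - aeval z g * aeval z⁻¹ g = aeval (z + z⁻¹) h := by
  obtain ⟨s, hs⟩ := exists_eval_add_inv_of_mul (residuePoly fun i => x (.r i))
  obtain ⟨t, ht⟩ := exists_eval_add_inv_of_mul (residuePoly fun i => x (.sr i))
  have key (z : ℂ) (hz : z ≠ 0) := congrArg₂ (· - ·) (hs z hz) (ht z hz)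
  simp only [← map_sub] at key
  refine ⟨_, _, s - t, ?_, key⟩
  have hn : 0 < n := NeZero.pos n
  rw [← Int.cast_inj (α := ℂ), resultant_chebyshevC_sub_two hn,
    groupDet_dihedral_eq_prod x (fun _ _ => rfl) (fun _ _ => rfl)]
  refine Finset.prod_congr rfl fun z hz => key z ?_
  rintro rfl
  simp [mem_nthRootsFinset hn, hn.ne'] at hz

end SymmetricForm

/-! ### Divisibility by powers of odd primes -/

section OddPrimes

open Polynomial

theorem chebyshevC_mul_nat (q m : ℕ) :
    Chebyshev.C ℤ ((q * m : ℕ) : ℤ) = (Chebyshev.C ℤ (q : ℤ)).comp (Chebyshev.C ℤ (m : ℤ)) := by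
  rw [Nat.cast_mul, Chebyshev.C_mul]

theorem Polynomial.Monic.comp_chebyshevC {P : ℤ[X]} (hP : P.Monic) {m : ℕ} (hm : m ≠ 0) :
    (P.comp (Chebyshev.C ℤ (m : ℤ))).Monic :=
  hP.comp (monic_chebyshevC hm) (by rwa [natDegree_chebyshevC hm])

theorem chebyshevC_odd_mul_sub_two (k m : ℕ) :
    Chebyshev.C ℤ (((2 * k + 1) * m : ℕ) : ℤ) - 2 =
      (Chebyshev.C ℤ (m : ℤ) - 2) * ((chebyshevV k).comp (Chebyshev.C ℤ (m : ℤ))) ^ 2 := by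
  have := congrArg (fun P => comp P (Chebyshev.C ℤ (m : ℤ))) (chebyshevC_odd_sub_two k)
  simp only [sub_comp, mul_comp, pow_comp, X_comp, ofNat_comp] at this
  rw [chebyshevC_mul_nat]
  push_cast at this ⊢
  exact this

theorem resultant_odd_mul (k : ℕ) {m : ℕ} (hm : m ≠ 0) (h : ℤ[X]) :
    (Chebyshev.C ℤ (((2 * k + 1) * m : ℕ) : ℤ) - 2).resultant h =
      (Chebyshev.C ℤ (m : ℤ) - 2).resultant h *
        ((chebyshevV k).comp (Chebyshev.C ℤ (m : ℤ))).resultant h ^ 2 := by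
  have hV := (monic_chebyshevV k).comp_chebyshevC hm
  rw [chebyshevC_odd_mul_sub_two, resultant_mul_of_monic (monic_chebyshevC_sub_two hm) (hV.pow 2),
    resultant_sq_of_monic hV]

theorem map_chebyshevC_prime_mul_sub_two (p : ℕ) [Fact p.Prime] (m : ℕ) :
    (Chebyshev.C ℤ ((p * m : ℕ) : ℤ) - 2).map (Int.castRingHom (ZMod p)) =
      ((Chebyshev.C ℤ (m : ℤ) - 2).map (Int.castRingHom (ZMod p))) ^ p := by
  have h2 : (2 : (ZMod p)[X]) ^ p = 2 := by
    have := congrArg (C : ZMod p →+* (ZMod p)[X]) (ZMod.pow_card (2 : ZMod p))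
    rwa [C_pow, C_ofNat] at this
  rw [chebyshevC_mul_nat]
  simp only [Polynomial.map_sub, Polynomial.map_comp, Chebyshev.map_C, Polynomial.map_ofNat]
  rw [chebyshevC_map_prime, X_pow_comp, sub_pow_char, h2]

theorem prime_dvd_resultant_of_mul {p : ℕ} [hp : Fact p.Prime] {m : ℕ} (hm : m ≠ 0) {h : ℤ[X]}
    (hd : (p : ℤ) ∣ (Chebyshev.C ℤ ((p * m : ℕ) : ℤ) - 2).resultant h) :
    (p : ℤ) ∣ (Chebyshev.C ℤ (m : ℤ) - 2).resultant h := by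
  rw [dvd_resultant_iff (monic_chebyshevC_sub_two (mul_ne_zero hp.out.ne_zero hm)),
    map_chebyshevC_prime_mul_sub_two, IsCoprime.pow_left_iff hp.out.pos] at hd
  rwa [dvd_resultant_iff (monic_chebyshevC_sub_two hm)]

theorem prime_dvd_resultant_chebyshevV {p k : ℕ} [hp : Fact p.Prime] (hpk : p = 2 * k + 1) {m : ℕ}
    (hm : m ≠ 0) {h : ℤ[X]} (hd : (p : ℤ) ∣ (Chebyshev.C ℤ (m : ℤ) - 2).resultant h) :
    (p : ℤ) ∣ ((chebyshevV k).comp (Chebyshev.C ℤ (m : ℤ))).resultant h := by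
  have hk : 0 < 2 * k := by have := hp.out.two_le; omega
  have hC := monic_chebyshevC_sub_two hm
  have hV := (monic_chebyshevV k).comp_chebyshevC hm
  have hfac := chebyshevC_odd_mul_sub_two k m
  rw [← hpk] at hfac
  have hmap := map_chebyshevC_prime_mul_sub_two p m
  rw [hfac, Polynomial.map_mul, Polynomial.map_pow] at hmap
  -- Cancelling one factor `C_m - 2` modulo `p` leaves `V_k(C_m)² = (C_m - 2)^(2k)`, so both bases
  -- share a factor with `h` or neither does.
  have hsq := mul_left_cancel₀ (hC.map (Int.castRingHom (ZMod p))).ne_zero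
    (hmap.trans ((congrArg (_ ^ ·) hpk).trans (pow_succ' _ _)))
  rw [dvd_resultant_iff hC, ← IsCoprime.pow_left_iff hk, ← hsq,
    IsCoprime.pow_left_iff two_pos, ← dvd_resultant_iff hV] at hd
  exact hd

theorem odd_prime_pow_dvd_resultant {p : ℕ} (hp : p.Prime) (hp2 : p ≠ 2) {m : ℕ} (hm : m ≠ 0)
    {h : ℤ[X]} (a : ℕ) (hd : (p : ℤ) ∣ (Chebyshev.C ℤ ((p ^ a * m : ℕ) : ℤ) - 2).resultant h) :
    (p : ℤ) ^ (2 * a + 1) ∣ (Chebyshev.C ℤ ((p ^ a * m : ℕ) : ℤ) - 2).resultant h := by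
  obtain ⟨k, rfl⟩ := hp.odd_of_ne_two hp2
  have : Fact (2 * k + 1).Prime := ⟨hp⟩
  induction a with
  | zero => simpa using hd
  | succ a ih =>
    have hm' : (2 * k + 1) ^ a * m ≠ 0 := mul_ne_zero (pow_ne_zero _ hp.ne_zero) hm
    rw [pow_succ' (2 * k + 1) a, mul_assoc] at hd ⊢
    have hd' := prime_dvd_resultant_of_mul hm' hd
    rw [resultant_odd_mul k hm', show 2 * (a + 1) + 1 = 2 * a + 1 + 2 by ring, pow_add]
    exact mul_dvd_mul (ih hd') (pow_dvd_pow_of_dvd (prime_dvd_resultant_chebyshevV rfl hm' hd') 2)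

end OddPrimes

/-! ### Corank of the Sylvester matrix modulo a prime -/

section Corank

open Polynomial Matrix

/-- Replacing column `i` by the combination with coefficients lifting `v` multiplies the determinant
by a lift `c` of `v i`, and the new column is `p` times an integer vector `u`. -/
theorem Matrix.exists_mul_det_eq_of_mulVec_eq_zero {ι : Type*} [Fintype ι] [DecidableEq ι] {p : ℕ}
    [Fact p.Prime] (A : Matrix ι ι ℤ) {v : ι → ZMod p} {i : ι} (hi : v i ≠ 0)
    (hv : A.map (Int.castRingHom (ZMod p)) *ᵥ v = 0) :
    ∃ (c : ℤ) (u : ι → ℤ), ¬ (p : ℤ) ∣ c ∧ c * A.det = p * (A.updateCol i u).det := by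
  have hcol (k : ι) : (p : ℤ) ∣ ∑ j, ((v j).val : ℤ) • A k j := by
    rw [← ZMod.intCast_zmod_eq_zero_iff_dvd]
    have := congrFun hv k
    simp only [mulVec, dotProduct, map_apply, eq_intCast, Pi.zero_apply] at this
    rw [← this]
    push_cast
    exact Finset.sum_congr rfl fun j _ => by
      rw [smul_eq_mul]; push_cast; rw [ZMod.natCast_zmod_val, mul_comm]
  choose u hu using hcol
  refine ⟨(v i).val, u, ?_, ?_⟩
  · rw [← ZMod.intCast_zmod_eq_zero_iff_dvd]
    simpa using hi
  · rw [← smul_eq_mul, ← det_updateCol_sum A i fun j => ((v j).val : ℤ), ← det_updateCol_smul]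
    congr 2
    ext k
    simpa using hu k

theorem Matrix.sq_dvd_det_of_kernel {ι : Type*} [Fintype ι] [DecidableEq ι] {p : ℕ}
    [hp : Fact p.Prime] (A : Matrix ι ι ℤ) {v w : ι → ZMod p}
    (hvw : LinearIndependent (ZMod p) ![v, w])
    (hv : A.map (Int.castRingHom (ZMod p)) *ᵥ v = 0)
    (hw : A.map (Int.castRingHom (ZMod p)) *ᵥ w = 0) : (p : ℤ) ^ 2 ∣ A.det := by
  rw [LinearIndependent.pair_iff] at hvw
  obtain ⟨i, hi⟩ : ∃ i, v i ≠ 0 := by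
    by_contra! h0
    exact one_ne_zero (hvw 1 0 (by ext i; simp [h0 i])).1
  -- A kernel vector vanishing at `i` stays in the kernel when column `i` is replaced, so the column
  -- argument can be used a second time.
  obtain ⟨w', hw', hw'i, j, hj⟩ : ∃ w' : ι → ZMod p,
      A.map (Int.castRingHom (ZMod p)) *ᵥ w' = 0 ∧ w' i = 0 ∧ ∃ j, w' j ≠ 0 := by
    refine ⟨(-(w i / v i)) • v + (1 : ZMod p) • w, ?_, ?_, ?_⟩
    · rw [mulVec_add, mulVec_smul, mulVec_smul, hv, hw, smul_zero, smul_zero, add_zero]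
    · simp [div_mul_cancel₀ _ hi]
    · by_contra! h0
      exact one_ne_zero (hvw _ _ (funext h0)).2
  obtain ⟨c, u, hc, hdet⟩ := A.exists_mul_det_eq_of_mulVec_eq_zero hi hv
  have hw'' : (A.updateCol i u).map (Int.castRingHom (ZMod p)) *ᵥ w' = 0 := by
    rw [← hw']
    ext k
    refine Finset.sum_congr rfl fun l _ => ?_
    by_cases hl : l = i
    · simp [hl, hw'i]
    · simp [updateCol_ne hl]
  obtain ⟨d, u', hd, hdet'⟩ := (A.updateCol i u).exists_mul_det_eq_of_mulVec_eq_zero hj hw''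
  have hpp : Prime (p : ℤ) := Nat.prime_iff_prime_int.mp hp.out
  have hcop : IsCoprime ((p : ℤ) ^ 2) (c * d) :=
    (IsCoprime.mul_right ((hpp.irreducible.coprime_iff_not_dvd).mpr hc)
      ((hpp.irreducible.coprime_iff_not_dvd).mpr hd)).pow_left
  refine hcop.dvd_of_dvd_mul_left ⟨((A.updateCol i u).updateCol j u').det, ?_⟩
  linear_combination d * hdet + p * hdet'

theorem sylvester_mulVec_eq_zero {K : Type*} [Field K] {P h q r : K[X]} {m n : ℕ}
    (hP : P.natDegree ≤ m) (hh : h.natDegree ≤ n) (hq : q ∈ degreeLT K m)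
    (hr : r ∈ degreeLT K n) (hz : P * r + h * q = 0) :
    P.sylvester h m n *ᵥ (((degreeLT.basis K m).prod (degreeLT.basis K n)).reindex
      finSumFinEquiv).repr (⟨q, hq⟩, ⟨r, hr⟩) = 0 := by
  rw [← toMatrix_sylvesterMap' P h hP hh, LinearMap.toMatrix_mulVec_repr]
  have : sylvesterMap P h hP hh (⟨q, hq⟩, ⟨r, hr⟩) = 0 := Subtype.ext hz
  rw [this, map_zero]
  rfl

/-- If `p` divides the resultant although there is no common root modulo `p`, the common factor
modulo `p` has degree at least two, and `p ^ 2` divides the resultant. -/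
theorem sq_dvd_resultant_of_no_common_root {p : ℕ} [Fact p.Prime] {P h : ℤ[X]} (hP : P.Monic)
    (hd : (p : ℤ) ∣ P.resultant h)
    (hroot : ∀ r : ZMod p, (P.map (Int.castRingHom (ZMod p))).IsRoot r →
      ¬ (h.map (Int.castRingHom (ZMod p))).IsRoot r) : (p : ℤ) ^ 2 ∣ P.resultant h := by
  rw [dvd_resultant_iff hP, ← EuclideanDomain.gcd_isUnit_iff] at hd
  set P' := P.map (Int.castRingHom (ZMod p)) with hP'
  set h' := h.map (Int.castRingHom (ZMod p)) with hh'
  have hP0 : P' ≠ 0 := (hP.map _).ne_zero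
  obtain ⟨q, hq⟩ := EuclideanDomain.gcd_dvd_left P' h'
  obtain ⟨s, hs⟩ := EuclideanDomain.gcd_dvd_right P' h'
  set c := EuclideanDomain.gcd P' h' with hc
  have hc0 : c ≠ 0 := by intro h0; rw [h0, zero_mul] at hq; exact hP0 hq
  have hq0 : q ≠ 0 := by rintro rfl; rw [mul_zero] at hq; exact hP0 hq
  have hdeg : 2 ≤ c.natDegree := by
    by_contra! hlt
    interval_cases hcd : c.natDegree
    · exact hd (isUnit_iff_degree_eq_zero.mpr (by rw [degree_eq_natDegree hc0, hcd]; rfl))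
    · obtain ⟨r, hr⟩ := exists_root_of_degree_eq_one
        (show c.degree = 1 by rw [degree_eq_natDegree hc0, hcd]; rfl)
      exact hroot r (by rw [hq]; exact root_mul_right_of_isRoot _ hr)
        (by rw [hs]; exact root_mul_right_of_isRoot _ hr)
  have hPm : P'.natDegree ≤ P.natDegree := natDegree_map_le
  have hhn : h'.natDegree ≤ h.natDegree := natDegree_map_le
  have hdq : q.natDegree + 2 ≤ P.natDegree := by
    have := natDegree_mul hc0 hq0
    rw [← hq] at this
    omega
  have hds (hs0 : s ≠ 0) : s.natDegree + 2 ≤ h.natDegree := by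
    have := natDegree_mul hc0 hs0
    rw [← hs] at this
    omega
  have mem_of {N : ℕ} {t : (ZMod p)[X]} (ht : t ≠ 0 → t.natDegree + 2 ≤ N) (e : ℕ) (he : e ≤ 1) :
      X ^ e * t ∈ degreeLT (ZMod p) N := by
    rw [mem_degreeLT]
    rcases eq_or_ne t 0 with rfl | ht0
    · rw [mul_zero, degree_zero]; exact WithBot.bot_lt_coe _
    · refine (natDegree_lt_iff_degree_lt (mul_ne_zero (pow_ne_zero _ X_ne_zero) ht0)).mp ?_
      rw [natDegree_mul (pow_ne_zero _ X_ne_zero) ht0, natDegree_X_pow]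
      have := ht ht0
      omega
  have hs' (hs0 : -s ≠ 0) : (-s).natDegree + 2 ≤ h.natDegree := by
    rw [natDegree_neg]; exact hds (neg_ne_zero.mp hs0)
  let b := ((degreeLT.basis (ZMod p) P.natDegree).prod
    (degreeLT.basis (ZMod p) h.natDegree)).reindex finSumFinEquiv
  -- With `P' = c q` and `h' = c s`, the syzygy `P' (-s) + h' q = 0` can also be multiplied by `X`,
  -- because `c` has degree at least `2`; this yields two independent kernel vectors.
  let vec (e : ℕ) (he : e ≤ 1) : degreeLT (ZMod p) P.natDegree × degreeLT (ZMod p) h.natDegree :=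
    (⟨X ^ e * q, mem_of (fun _ => hdq) e he⟩, ⟨X ^ e * -s, mem_of hs' e he⟩)
  have hker (e : ℕ) (he : e ≤ 1) :
      (P.sylvester h P.natDegree h.natDegree).map (Int.castRingHom (ZMod p)) *ᵥ
        b.repr (vec e he) = 0 := by
    rw [← RingHom.mapMatrix_apply, ← sylvester_map_map]
    exact sylvester_mulVec_eq_zero hPm hhn _ _ (by
      show P' * (X ^ e * -s) + h' * (X ^ e * q) = 0
      rw [hq, hs]; ring)
  refine Matrix.sq_dvd_det_of_kernel _ ?_ (hker 0 zero_le_one) (hker 1 le_rfl)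
  rw [LinearIndependent.pair_iff]
  intro x y hxy
  rw [← Finsupp.coe_smul, ← Finsupp.coe_smul, ← Finsupp.coe_add, ← Finsupp.coe_zero,
    DFunLike.coe_injective.eq_iff, ← map_smul, ← map_smul, ← map_add,
    LinearEquiv.map_eq_zero_iff] at hxy
  have h1 := congrArg (fun t => (t.1 : (ZMod p)[X])) hxy
  simp only [vec, Prod.fst_add, Prod.smul_fst, Submodule.coe_add, Submodule.coe_smul,
    Prod.fst_zero, Submodule.coe_zero, smul_eq_C_mul, pow_zero, pow_one] at h1
  have h2 : C x + C y * X = 0 := by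
    refine (mul_eq_zero.mp (?_ : (C x + C y * X) * q = 0)).resolve_right hq0
    rw [← h1]; ring
  have hx := congrArg (coeff · 0) h2
  have hy := congrArg (coeff · 1) h2
  simp at hx hy
  exact ⟨hx, by simpa [coeff_C] using hy⟩

end Corank

/-! ### Parity of the factors attached to the odd part of `n` -/

section EvenDeterminants

open Polynomial

/-- The cofactor of `X` in the Chebyshev polynomial `C_{2k+1}`. -/
noncomputable def chebyshevOddCofactor (k : ℕ) : ℤ[X] := (X_dvd_chebyshevC_odd k).choose

theorem chebyshevC_odd (k : ℕ) : Chebyshev.C ℤ (2 * k + 1 : ℤ) = X * chebyshevOddCofactor k :=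
  (X_dvd_chebyshevC_odd k).choose_spec

theorem monic_chebyshevOddCofactor (k : ℕ) : (chebyshevOddCofactor k).Monic := by
  refine monic_X.of_mul_monic_left ?_
  rw [← chebyshevC_odd]
  exact_mod_cast monic_chebyshevC (n := 2 * k + 1) (by omega)

theorem resultant_chebyshevC_odd_sub_two (k : ℕ) (h : ℤ[X]) :
    (Chebyshev.C ℤ ((2 * k + 1 : ℕ) : ℤ) - 2).resultant h =
      h.eval 2 * (chebyshevV k).resultant h ^ 2 := by
  have h2 : (X - 2 : ℤ[X]) = X - C 2 := by simp
  push_cast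
  rw [chebyshevC_odd_sub_two, h2, resultant_mul_of_monic (monic_X_sub_C 2)
    ((monic_chebyshevV k).pow 2), resultant_X_sub_C_eq_eval,
    resultant_sq_of_monic (monic_chebyshevV k)]

theorem resultant_chebyshevC_odd_add_two (k : ℕ) (h : ℤ[X]) :
    (Chebyshev.C ℤ ((2 * k + 1 : ℕ) : ℤ) + 2).resultant h =
      h.eval (-2) * (chebyshevW k).resultant h ^ 2 := by
  have h2 : (X + 2 : ℤ[X]) = X - C (-2) := by simp
  push_cast
  rw [chebyshevC_odd_add_two, h2, resultant_mul_of_monic (monic_X_sub_C (-2))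
    ((monic_chebyshevW k).pow 2), resultant_X_sub_C_eq_eval,
    resultant_sq_of_monic (monic_chebyshevW k)]

theorem resultant_chebyshevC_odd (k : ℕ) (h : ℤ[X]) :
    (Chebyshev.C ℤ ((2 * k + 1 : ℕ) : ℤ)).resultant h =
      h.eval 0 * (chebyshevOddCofactor k).resultant h := by
  have h2 : (X : ℤ[X]) = X - C 0 := by simp
  push_cast
  rw [chebyshevC_odd]
  conv_lhs => rw [h2]
  rw [resultant_mul_of_monic (monic_X_sub_C 0) (monic_chebyshevOddCofactor k), resultant_X_sub_C_eq_eval]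

theorem resultant_chebyshevC_two_mul_sub_two {m : ℕ} (hm : m ≠ 0) (h : ℤ[X]) :
    (Chebyshev.C ℤ ((2 * m : ℕ) : ℤ) - 2).resultant h =
      (Chebyshev.C ℤ (m : ℤ) - 2).resultant h * (Chebyshev.C ℤ (m : ℤ) + 2).resultant h := by
  have hadd : (Chebyshev.C ℤ (m : ℤ) + 2).Monic := by
    simpa using monic_chebyshevC_add_C hm 2
  have hfac : Chebyshev.C ℤ ((2 * m : ℕ) : ℤ) - 2 =
      (Chebyshev.C ℤ (m : ℤ) - 2) * (Chebyshev.C ℤ (m : ℤ) + 2) := by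
    push_cast
    rw [chebyshevC_two_mul]
    ring
  rw [hfac, resultant_mul_of_monic (monic_chebyshevC_sub_two hm) hadd]

theorem resultant_chebyshevC_four_mul_sub_two {m : ℕ} (hm : m ≠ 0) (h : ℤ[X]) :
    (Chebyshev.C ℤ ((4 * m : ℕ) : ℤ) - 2).resultant h =
      (Chebyshev.C ℤ (m : ℤ) - 2).resultant h * (Chebyshev.C ℤ (m : ℤ) + 2).resultant h *
        (Chebyshev.C ℤ (m : ℤ)).resultant h ^ 2 := by
  have h4 : (Chebyshev.C ℤ ((2 * m : ℕ) : ℤ) + 2) = Chebyshev.C ℤ (m : ℤ) ^ 2 := by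
    push_cast
    rw [chebyshevC_two_mul]
    ring
  rw [show 4 * m = 2 * (2 * m) by ring, resultant_chebyshevC_two_mul_sub_two (by omega),
    resultant_chebyshevC_two_mul_sub_two hm, h4, resultant_sq_of_monic (monic_chebyshevC hm)]

/-- Since `C_j(2) = 2`, `X - 2` divides `C_j - 2`; substitute `C_m` for `X`. -/
theorem resultant_chebyshevC_sub_two_dvd {m j : ℕ} (hm : m ≠ 0) (hj : j ≠ 0) (h : ℤ[X]) :
    (Chebyshev.C ℤ (m : ℤ) - 2).resultant h ∣ (Chebyshev.C ℤ ((j * m : ℕ) : ℤ) - 2).resultant h := by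
  obtain ⟨Q, hQ⟩ : (X - C 2 : ℤ[X]) ∣ Chebyshev.C ℤ (j : ℤ) - 2 := by
    rw [dvd_iff_isRoot]
    simp
  have hfac : Chebyshev.C ℤ ((j * m : ℕ) : ℤ) - 2 =
      (Chebyshev.C ℤ (m : ℤ) - 2) * Q.comp (Chebyshev.C ℤ (m : ℤ)) := by
    have := congrArg (fun P => comp P (Chebyshev.C ℤ (m : ℤ))) hQ
    simp only [sub_comp, mul_comp, X_comp, ofNat_comp, C_comp] at this
    rw [chebyshevC_mul_nat]
    exact this
  have hmon := monic_chebyshevC_sub_two hm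
  have hQm : (Q.comp (Chebyshev.C ℤ (m : ℤ))).Monic := by
    refine hmon.of_mul_monic_left ?_
    rw [← hfac]
    exact monic_chebyshevC_sub_two (mul_ne_zero hj hm)
  rw [hfac, resultant_mul_of_monic hmon hQm]
  exact dvd_mul_right _ _

theorem two_dvd_resultant_chebyshevW_iff (k : ℕ) (h : ℤ[X]) :
    2 ∣ (chebyshevW k).resultant h ↔ 2 ∣ (chebyshevV k).resultant h := by
  have h1 := dvd_resultant_iff (p := 2) (monic_chebyshevW k) h
  have h2 := dvd_resultant_iff (p := 2) (monic_chebyshevV k) h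
  have h3 : (chebyshevW k).map (Int.castRingHom (ZMod 2)) =
      (chebyshevV k).map (Int.castRingHom (ZMod 2)) := by
    simp [chebyshevV, chebyshevW, CharTwo.sub_eq_add]
  rw [h3] at h1
  exact_mod_cast h1.trans h2.symm

theorem two_dvd_resultant_chebyshevOddCofactor_iff (k : ℕ) (h : ℤ[X]) :
    2 ∣ (chebyshevOddCofactor k).resultant h ↔ 2 ∣ (chebyshevV k).resultant h := by
  have h1 := dvd_resultant_iff (p := 2) (monic_chebyshevOddCofactor k) h
  have h2 := dvd_resultant_iff (p := 2) (monic_chebyshevV k) h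
  -- Modulo `2` the polynomial `C_{2k+1}` is both `X V²` and `X U`.
  have h3 : (chebyshevOddCofactor k).map (Int.castRingHom (ZMod 2)) =
      (chebyshevV k).map (Int.castRingHom (ZMod 2)) ^ 2 := by
    have h0 : (2 : (ZMod 2)[X]) = 0 := CharTwo.two_eq_zero
    have := congrArg (map (Int.castRingHom (ZMod 2))) (chebyshevC_odd_sub_two k)
    rw [chebyshevC_odd] at this
    simp only [Polynomial.map_sub, Polynomial.map_mul, Polynomial.map_pow, map_X,
      Polynomial.map_ofNat, h0, sub_zero] at this
    exact mul_left_cancel₀ X_ne_zero this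
  rw [h3, IsCoprime.pow_left_iff two_pos] at h1
  exact_mod_cast h1.trans h2.symm

theorem exists_even_odd_parts (h : ℤ[X]) : ∃ E O : ℤ[X], h = E.comp (X ^ 2) + X * O.comp (X ^ 2) := by
  induction h using Polynomial.induction_on' with
  | add p q hp hq =>
    obtain ⟨E, O, rfl⟩ := hp
    obtain ⟨E', O', rfl⟩ := hq
    exact ⟨E + E', O + O', by simp only [add_comp]; ring⟩
  | monomial n c =>
    obtain ⟨k, rfl | rfl⟩ := n.even_or_odd'
    · exact ⟨monomial k c, 0, by simp [← C_mul_X_pow_eq_monomial, pow_mul]⟩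
    · exact ⟨0, monomial k c, by simp [← C_mul_X_pow_eq_monomial, pow_mul, pow_succ']; ring⟩

/-- This is the norm of `h(√3) = E(3) + √3 O(3)`. -/
theorem resultant_X_sq_sub_three {h E O : ℤ[X]} (hEO : h = E.comp (X ^ 2) + X * O.comp (X ^ 2)) :
    (X ^ 2 - 3 : ℤ[X]).resultant h = E.eval 3 ^ 2 - 3 * O.eval 3 ^ 2 := by
  obtain ⟨s, hs⟩ : ∃ s : ℂ, s ^ 2 = 3 := ⟨_, IsAlgClosed.exists_pow_nat_eq 3 two_pos |>.choose_spec⟩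
  have hmon : (X ^ 2 - 3 : ℤ[X]).Monic := by
    rw [show (3 : ℤ[X]) = C 3 from rfl]
    exact monic_X_pow_sub_C 3 two_ne_zero
  have hC : (C s : ℂ[X]) ^ 2 = 3 := by rw [← C_pow, hs]; rfl
  have hfac : (X ^ 2 - 3 : ℤ[X]).map (Int.castRingHom ℂ) = (X - C s) * (X - C (-s)) := by
    simp only [Polynomial.map_sub, Polynomial.map_pow, map_X, Polynomial.map_ofNat, C_neg]
    linear_combination hC
  have hev (t : ℂ) (ht : t ^ 2 = 3) : eval t (h.map (Int.castRingHom ℂ)) =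
      (E.eval 3 : ℤ) + t * (O.eval 3 : ℤ) := by
    have h3 (P : ℤ[X]) : eval (3 : ℂ) (P.map (Int.castRingHom ℂ)) = ((P.eval 3 : ℤ) : ℂ) := by
      have := eval_intCast_map (Int.castRingHom ℂ) P 3
      simpa using this
    rw [hEO]
    simp [eval_comp, Polynomial.map_comp, ht, h3]
  rw [← Int.cast_inj (α := ℂ), ← eq_intCast (Int.castRingHom ℂ), resultant_map_eq _ hmon, hfac,
    (monic_X_sub_C s).natDegree_mul (monic_X_sub_C (-s)), resultant_mul_left _ _ _ _ le_rfl]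
  simp only [natDegree_X_sub_C]
  rw [resultant_X_sub_C_left _ _ _ le_rfl, resultant_X_sub_C_left _ _ _ le_rfl, hev s hs,
    hev (-s) (by rw [neg_sq, hs])]
  push_cast
  linear_combination (-(O.eval 3 : ℤ) ^ 2 : ℂ) * hs

theorem sixteen_dvd_mul_resultant {h : ℤ[X]} (h1 : 2 ∣ h.eval 1) :
    16 ∣ h.eval (-1) * h.eval 1 * (X ^ 2 - 3 : ℤ[X]).resultant h := by
  obtain ⟨E, O, hEO⟩ := exists_even_odd_parts h
  have e1 : h.eval 1 = E.eval 1 + O.eval 1 := by rw [hEO]; simp [eval_comp]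
  have e2 : h.eval (-1) = E.eval 1 - O.eval 1 := by rw [hEO]; simp [eval_comp]; ring
  have hE : (3 - 1 : ℤ) ∣ E.eval 3 - E.eval 1 := sub_dvd_eval_sub 3 1 E
  have hO : (3 - 1 : ℤ) ∣ O.eval 3 - O.eval 1 := sub_dvd_eval_sub 3 1 O
  rw [resultant_X_sq_sub_three hEO, e2, e1]
  rw [e1] at h1
  obtain ⟨a, ha⟩ := hE
  obtain ⟨b, hb⟩ := hO
  obtain ⟨c, hc⟩ := h1
  rw [show E.eval 3 = E.eval 1 + 2 * a by linarith, show O.eval 3 = O.eval 1 + 2 * b by linarith,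
    show E.eval 1 = 2 * c - O.eval 1 by linarith]
  generalize O.eval 1 = o
  -- `E(1)` and `O(1)` have equal parity, shared by `E(3)` and `O(3)`. If even, the three factors
  -- give `2 · 2 · 4`; if odd, `E(1)² - O(1)²` is divisible by `8` and the norm is even.
  rcases Int.even_or_odd' o with ⟨d, rfl | rfl⟩
  · exact ⟨(c - 2 * d) * c * ((c - d + a) ^ 2 - 3 * (d + b) ^ 2), by ring⟩
  · rcases Int.even_or_odd' c with ⟨e, rfl | rfl⟩
    · exact ⟨e * (2 * e - 2 * d - 1) * (2 * (2 * e - d - 1 + a) ^ 2 + 2 * (2 * e - d - 1 + a)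
        - 6 * (d + b) ^ 2 - 6 * (d + b) - 1), by ring⟩
    · exact ⟨(2 * e + 1) * (e - d) * (2 * (2 * e - d + a) ^ 2 + 2 * (2 * e - d + a)
        - 6 * (d + b) ^ 2 - 6 * (d + b) - 1), by ring⟩

/-- Here `-1 = ω + ω⁻¹` for a primitive cube root of unity `ω`, so the values have period `3`. -/
theorem chebyshevC_eval_neg_one (j : ℕ) :
    (Chebyshev.C ℤ (3 * j : ℤ)).eval (-1) = 2 ∧ (Chebyshev.C ℤ (3 * j + 1 : ℤ)).eval (-1) = -1 ∧
      (Chebyshev.C ℤ (3 * j + 2 : ℤ)).eval (-1) = -1 := by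
  induction j with
  | zero => simp [Chebyshev.C_two]
  | succ j ih =>
    obtain ⟨-, h1, h2⟩ := ih
    have h3 := congrArg (eval (-1)) (Chebyshev.C_add_two ℤ (3 * j + 1 : ℤ))
    have h4 := congrArg (eval (-1)) (Chebyshev.C_add_two ℤ (3 * j + 2 : ℤ))
    have h5 := congrArg (eval (-1)) (Chebyshev.C_add_two ℤ (3 * j + 3 : ℤ))
    simp only [eval_sub, eval_mul, eval_X] at h3 h4 h5
    push_cast
    ring_nf at *
    simp only [h1, h2] at h3
    simp only [h3, h2] at h4
    simp only [h3, h4] at h5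
    simp [h3, h4, h5]

/-- If `3 ∤ 2k+1`, then `-3 V(-1)² = -1 - 2`, so `V(-1)` is odd. Hence `3 ∣ 2k+1`, and `C_{2k+1}` is
an odd-index `C` composed with `C_3 = X (X² - 3)`, which takes the values `2` at `-1` and `-2` at
`1`. -/
theorem dvd_factors_of_two_dvd_eval {k : ℕ} (hV : 2 ∣ (chebyshevV k).eval (-1)) :
    (X - C (-1)) ∣ chebyshevV k ∧ (X - C 1) ∣ chebyshevW k ∧ (X ^ 2 - 3) ∣ chebyshevOddCofactor k := by
  have h0 := congrArg (eval (-1)) (chebyshevC_odd_sub_two k)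
  simp only [eval_sub, eval_mul, eval_X, eval_pow, eval_ofNat] at h0
  obtain ⟨c, hc⟩ := hV
  obtain ⟨j, hj⟩ : 3 ∣ 2 * k + 1 := by
    by_contra h3
    have : (Chebyshev.C ℤ (2 * k + 1 : ℤ)).eval (-1) = -1 := by
      have hdiv := Nat.div_add_mod (2 * k + 1) 3
      have hlt := Nat.mod_lt (2 * k + 1) three_pos
      have hpos : (2 * k + 1) % 3 ≠ 0 := fun h => h3 (Nat.dvd_of_mod_eq_zero h)
      obtain ⟨-, h1, h2⟩ := chebyshevC_eval_neg_one ((2 * k + 1) / 3)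
      have hcast : (2 * k + 1 : ℤ) = 3 * ((2 * k + 1) / 3 : ℕ) + ((2 * k + 1) % 3 : ℕ) := by
        exact_mod_cast hdiv.symm
      rw [hcast]
      rcases (by omega : (2 * k + 1) % 3 = 1 ∨ (2 * k + 1) % 3 = 2) with h | h <;> rw [h]
      · exact h1
      · exact h2
    rw [this, hc] at h0
    have h0' : 1 = 4 * c ^ 2 := by linarith
    omega
  obtain ⟨i, rfl⟩ : ∃ i, j = 2 * i + 1 := ⟨j / 2, by omega⟩
  have hC3 : Chebyshev.C ℤ 3 = X ^ 3 - 3 * X := by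
    have := Chebyshev.C_add_two ℤ 1
    norm_num [Chebyshev.C_two] at this
    rw [this]; ring
  have hcast : (2 * k + 1 : ℤ) = (2 * i + 1) * 3 := by exact_mod_cast hj.trans (mul_comm _ _)
  have hcomp : Chebyshev.C ℤ (2 * k + 1 : ℤ) =
      (Chebyshev.C ℤ (2 * i + 1 : ℤ)).comp (X ^ 3 - 3 * X) := by
    rw [hcast, Chebyshev.C_mul, hC3]
  have hadd : (Chebyshev.C ℤ (2 * i + 1 : ℤ)).eval (-2) = -2 := by
    have := congrArg (eval (-2)) (chebyshevC_odd_add_two i)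
    simp only [eval_add, eval_mul, eval_X, eval_ofNat, neg_add_cancel, zero_mul] at this
    linarith
  refine ⟨?_, ?_, ?_⟩
  · rw [dvd_iff_isRoot, IsRoot]
    have h2 : (Chebyshev.C ℤ (2 * k + 1 : ℤ)).eval (-1) = 2 := by
      rw [hcomp, eval_comp]
      norm_num
    rw [h2] at h0
    nlinarith
  · rw [dvd_iff_isRoot, IsRoot]
    have h1 := congrArg (eval 1) (chebyshevC_odd_add_two k)
    rw [hcomp] at h1
    norm_num [eval_comp, hadd] at h1
    exact h1
  · obtain ⟨Q, hQ⟩ := X_dvd_chebyshevC_odd i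
    rw [hQ, chebyshevC_odd] at hcomp
    refine ⟨Q.comp (X ^ 3 - 3 * X), mul_left_cancel₀ X_ne_zero (hcomp.trans ?_)⟩
    rw [mul_comp, X_comp]
    ring

/-- When the value at `0` is odd, the three resultants with the nonrational factors of
`C_{4m} - 2` have product divisible by `16` as soon as one of them is even. -/
theorem sixteen_dvd_resultants {k : ℕ} {h : ℤ[X]} (h0 : ¬ 2 ∣ h.eval 0)
    (hV : 2 ∣ (chebyshevV k).resultant h) :
    16 ∣ (chebyshevV k).resultant h * (chebyshevW k).resultant h * (chebyshevOddCofactor k).resultant h := by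
  have hW := (two_dvd_resultant_chebyshevW_iff k h).mpr hV
  have hU := (two_dvd_resultant_chebyshevOddCofactor_iff k h).mpr hV
  by_cases h4 : 4 ∣ (chebyshevV k).resultant h
  · exact mul_dvd_mul (mul_dvd_mul h4 hW) hU
  -- Without a common root the common factor modulo `2` would have degree at least `2`, forcing `4`
  -- to divide the resultant with `V`.
  have hroot : ∃ r : ZMod 2, ((chebyshevV k).map (Int.castRingHom (ZMod 2))).IsRoot r ∧
      (h.map (Int.castRingHom (ZMod 2))).IsRoot r := by
    by_contra! hno
    have hsq := sq_dvd_resultant_of_no_common_root (p := 2) (monic_chebyshevV k)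
      (by exact_mod_cast hV) hno
    exact h4 (by simpa using hsq)
  have heval (P : ℤ[X]) (c : ℤ) (hP : (P.map (Int.castRingHom (ZMod 2))).IsRoot (c : ZMod 2)) :
      2 ∣ P.eval c := by
    have h1 := eval_intCast_map (Int.castRingHom (ZMod 2)) P c
    rw [show eval (c : ZMod 2) (P.map (Int.castRingHom (ZMod 2))) = 0 from hP] at h1
    exact_mod_cast (ZMod.intCast_zmod_eq_zero_iff_dvd _ 2).mp h1.symm
  obtain ⟨r, hrV, hrh⟩ := hroot
  obtain rfl : r = 1 := by
    rcases (by decide : ∀ r : ZMod 2, r = 0 ∨ r = 1) r with rfl | rfl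
    · exact absurd (heval h 0 (by rwa [Int.cast_zero])) h0
    · rfl
  obtain ⟨⟨A, hA⟩, ⟨B, hB⟩, ⟨D, hD⟩⟩ :=
    dvd_factors_of_two_dvd_eval (k := k) (heval _ (-1) (by
      rwa [show ((-1 : ℤ) : ZMod 2) = 1 from rfl]))
  have hmA : A.Monic := (monic_X_sub_C (-1 : ℤ)).of_mul_monic_left (hA ▸ monic_chebyshevV k)
  have hmB : B.Monic := (monic_X_sub_C (1 : ℤ)).of_mul_monic_left (hB ▸ monic_chebyshevW k)
  have hm3 : (X ^ 2 - 3 : ℤ[X]).Monic := by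
    rw [show (3 : ℤ[X]) = C 3 from rfl]
    exact monic_X_pow_sub_C 3 two_ne_zero
  have hmD : D.Monic := hm3.of_mul_monic_left (hD ▸ monic_chebyshevOddCofactor k)
  have h16 := sixteen_dvd_mul_resultant (heval h 1 (by simpa using hrh))
  rw [hA, hB, hD, resultant_mul_of_monic (monic_X_sub_C _) hmA,
    resultant_mul_of_monic (monic_X_sub_C _) hmB, resultant_mul_of_monic hm3 hmD,
    resultant_X_sub_C_eq_eval, resultant_X_sub_C_eq_eval]
  refine (h16.mul_right (A.resultant h * B.resultant h * D.resultant h)).trans (dvd_of_eq ?_)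
  ring

end EvenDeterminants

/-! ### Divisibility of dihedral determinants -/

section DivisibilityOfDeterminants

open Polynomial

theorem two_dvd_sub_sq {a b : ℤ} (h : 2 ∣ a ^ 2 - b ^ 2) : 4 ∣ a ^ 2 - b ^ 2 := by
  have h1 : (2 : ℤ) ∣ a - b := by
    by_contra hab
    have hodd : Odd (a - b) := Int.not_even_iff_odd.mp fun h => hab h.two_dvd
    have : Odd ((a - b) * (a + b)) := hodd.mul (by
      rw [show a + b = a - b + 2 * b by ring]
      exact hodd.add_even (even_two_mul b))
    rw [show a ^ 2 - b ^ 2 = (a - b) * (a + b) by ring] at h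
    exact Int.not_even_iff_odd.mpr this (even_iff_two_dvd.mpr h)
  have h2 : (2 : ℤ) ∣ a + b := by omega
  rw [show a ^ 2 - b ^ 2 = (a - b) * (a + b) by ring]
  exact mul_dvd_mul h1 h2

/-- Even determinants of the dihedral group of order `8`, written in terms of the even and odd
parts of the two coefficient polynomials. -/
theorem dvd_dihedral_four {e o u v e' o' u' v' : ℤ} (he : 2 ∣ e' - e) (ho : 2 ∣ o' - o)
    (hu : 2 ∣ u' - u) (hv : 2 ∣ v' - v) (h : 2 ∣ e' ^ 2 + o' ^ 2 - (u' ^ 2 + v' ^ 2)) :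
    256 ∣ ((e + o) ^ 2 - (u + v) ^ 2) * ((e - o) ^ 2 - (u - v) ^ 2) *
      (e' ^ 2 + o' ^ 2 - (u' ^ 2 + v' ^ 2)) ^ 2 := by
  obtain ⟨a, ha⟩ := he
  obtain ⟨b, hb⟩ := ho
  obtain ⟨c, hc⟩ := hu
  obtain ⟨d, hd⟩ := hv
  obtain rfl : e' = e + 2 * a := by linarith
  obtain rfl : o' = o + 2 * b := by linarith
  obtain rfl : u' = u + 2 * c := by linarith
  obtain rfl : v' = v + 2 * d := by linarith
  have hs : 2 ∣ e + o + u + v := by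
    have : (e + 2 * a) ^ 2 + (o + 2 * b) ^ 2 - ((u + 2 * c) ^ 2 + (v + 2 * d) ^ 2) =
        (e * (e - 1) + o * (o - 1) - u * (u + 1) - v * (v + 1)) + (e + o + u + v) +
        2 * (2 * e * a + 2 * a ^ 2 + 2 * o * b + 2 * b ^ 2 - 2 * u * c - 2 * c ^ 2 - 2 * v * d
          - 2 * d ^ 2) := by ring
    have h1 := (Int.even_mul_pred_self e).two_dvd
    have h2 := (Int.even_mul_pred_self o).two_dvd
    have h3 := (Int.even_mul_succ_self u).two_dvd
    have h4 := (Int.even_mul_succ_self v).two_dvd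
    omega
  obtain ⟨s, hs⟩ := hs
  obtain rfl : e = 2 * s - o - u - v := by linarith
  clear h ha hb hc hd hs
  obtain ⟨t, ht⟩ : ∃ t, (2 * s - o - u - v + 2 * a) ^ 2 + (o + 2 * b) ^ 2 -
      ((u + 2 * c) ^ 2 + (v + 2 * d) ^ 2) = 2 * ((o + u) * (o + v) + 2 * t) :=
    ⟨s ^ 2 - s * (o + u + v) + (2 * s - o - u - v) * a + a ^ 2 + o * b + b ^ 2 - u * c
      - c ^ 2 - v * d - d ^ 2, by ring⟩
  have hA : (2 * s - o - u - v + o) ^ 2 - (u + v) ^ 2 = 4 * (s * (s - u - v)) := by ring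
  have hB : (2 * s - o - u - v - o) ^ 2 - (u - v) ^ 2 = 4 * ((s - o - v) * (s - o - u)) := by ring
  -- The three factors already supply `4 · 4 · 2² = 64`. The missing `4` comes from the last square
  -- if `(o+u)(o+v)` is even. Otherwise `u` and `v` have the parity opposite to `o`, and one of the
  -- two products has both its factors even, depending on the parity of `s`.
  have key : 4 ∣ (s * (s - u - v)) * ((s - o - v) * (s - o - u)) *
      ((o + u) * (o + v) + 2 * t) ^ 2 := by
    by_cases h1 : 2 ∣ (o + u) * (o + v)
    · have : (2 : ℤ) ∣ (o + u) * (o + v) + 2 * t := by omega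
      exact ((by norm_num : (4 : ℤ) = 2 ^ 2) ▸ pow_dvd_pow_of_dvd this 2).mul_left _
    · have h2 : ¬ (2 : ℤ) ∣ o + u := fun h => h1 (h.mul_right _)
      have h3 : ¬ (2 : ℤ) ∣ o + v := fun h => h1 (h.mul_left _)
      refine Dvd.dvd.mul_right ?_ _
      rcases Int.even_or_odd' s with ⟨w, hw | hw⟩
      · exact (mul_dvd_mul (by omega : (2 : ℤ) ∣ s) (by omega : (2 : ℤ) ∣ s - u - v)).mul_right _
      · exact (mul_dvd_mul (by omega : (2 : ℤ) ∣ s - o - v)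
          (by omega : (2 : ℤ) ∣ s - o - u)).mul_left _
  rw [hA, hB, ht]
  refine (mul_dvd_mul_left 64 key).trans (dvd_of_eq ?_)
  generalize s * (s - u - v) = A
  generalize (s - o - v) * (s - o - u) = B
  generalize (o + u) * (o + v) + 2 * t = K
  ring

theorem aeval_intCast_eq (P : ℤ[X]) (c : ℤ) : aeval (c : ℂ) P = ((P.eval c : ℤ) : ℂ) := by
  rw [← eq_intCast (algebraMap ℤ ℂ) c, aeval_algebraMap_apply]
  simp

/-- The rational and Gaussian values of a polynomial `h` with
`h (z + z⁻¹) = f z * f z⁻¹ - g z * g z⁻¹`. -/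
theorem even_eval_of_symmetric {f g h : ℤ[X]}
    (hfg : ∀ z : ℂ, z ≠ 0 →
      aeval z f * aeval z⁻¹ f - aeval z g * aeval z⁻¹ g = aeval (z + z⁻¹) h) :
    (2 ∣ h.eval 2 → 4 ∣ h.eval 2) ∧ (2 ∣ h.eval (-2) → 4 ∣ h.eval (-2)) ∧
      (2 ∣ h.eval 0 → 256 ∣ h.eval 2 * h.eval (-2) * h.eval 0 ^ 2) := by
  have h1 : h.eval 2 = f.eval 1 ^ 2 - g.eval 1 ^ 2 := by
    have := hfg ((1 : ℤ) : ℂ) (by simp)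
    rw [show ((1 : ℤ) : ℂ)⁻¹ = ((1 : ℤ) : ℂ) by simp,
      show ((1 : ℤ) : ℂ) + ((1 : ℤ) : ℂ) = ((2 : ℤ) : ℂ) by norm_num] at this
    simp only [aeval_intCast_eq] at this
    rw [sq, sq]
    exact_mod_cast this.symm
  have h2 : h.eval (-2) = f.eval (-1) ^ 2 - g.eval (-1) ^ 2 := by
    have := hfg ((-1 : ℤ) : ℂ) (by simp)
    rw [show ((-1 : ℤ) : ℂ)⁻¹ = ((-1 : ℤ) : ℂ) by norm_num,
      show ((-1 : ℤ) : ℂ) + ((-1 : ℤ) : ℂ) = ((-2 : ℤ) : ℂ) by norm_num] at this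
    simp only [aeval_intCast_eq] at this
    rw [sq, sq]
    exact_mod_cast this.symm
  refine ⟨fun hd => ?_, fun hd => ?_, fun hd => ?_⟩
  · rw [h1] at hd ⊢; exact two_dvd_sub_sq hd
  · rw [h2] at hd ⊢; exact two_dvd_sub_sq hd
  obtain ⟨E, O, rfl⟩ := exists_even_odd_parts f
  obtain ⟨U, V, rfl⟩ := exists_even_odd_parts g
  have hcast (P : ℤ[X]) : aeval (-1 : ℂ) P = ((P.eval (-1) : ℤ) : ℂ) := by
    simpa using aeval_intCast_eq P (-1)
  have h0 : h.eval 0 = E.eval (-1) ^ 2 + O.eval (-1) ^ 2 - (U.eval (-1) ^ 2 + V.eval (-1) ^ 2) := by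
    -- At `z = i` one has `z² = -1`, so `f(i) f(-i) = E(-1)² + O(-1)²`, and likewise for `g`.
    have := hfg Complex.I Complex.I_ne_zero
    rw [Complex.inv_I, add_neg_cancel, ← Int.cast_zero, aeval_intCast_eq] at this
    simp only [map_add, map_mul, aeval_comp, map_pow, aeval_X, neg_sq, Complex.I_sq, hcast] at this
    rw [← Int.cast_inj (α := ℂ), ← this]
    push_cast
    linear_combination ((V.eval (-1) : ℤ) ^ 2 - (O.eval (-1) : ℤ) ^ 2 : ℂ) * Complex.I_sq
  have hpar (P : ℤ[X]) : 2 ∣ P.eval (-1) - P.eval 1 := by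
    rw [← dvd_neg, neg_sub]
    exact (by norm_num : (1 - -1 : ℤ) = 2) ▸ sub_dvd_eval_sub 1 (-1) P
  rw [h0] at hd
  rw [h1, h2, h0]
  convert dvd_dihedral_four (hpar E) (hpar O) (hpar U) (hpar V) hd using 3 <;>
    · simp [eval_comp]; try ring

theorem prime_dvd_resultant_of_pow_mul {p : ℕ} [hp : Fact p.Prime] {m : ℕ} (hm : m ≠ 0)
    {h : ℤ[X]} (a : ℕ) (hd : (p : ℤ) ∣ (Chebyshev.C ℤ ((p ^ a * m : ℕ) : ℤ) - 2).resultant h) :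
    (p : ℤ) ∣ (Chebyshev.C ℤ (m : ℤ) - 2).resultant h := by
  induction a with
  | zero => rwa [pow_zero, one_mul] at hd
  | succ a ih =>
    rw [pow_succ', mul_assoc] at hd
    exact ih (prime_dvd_resultant_of_mul (mul_ne_zero (pow_ne_zero _ hp.out.ne_zero) hm) hd)

theorem dvd_groupDet_dihedral_of_even {n : ℕ} [NeZero n] (x : DihedralGroup n → ℤ)
    (hd : 2 ∣ groupDet x) : 4 ∣ groupDet x ∧ (2 ∣ n → 16 ∣ groupDet x) ∧
      (4 ∣ n → 256 ∣ groupDet x) := by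
  obtain ⟨f, g, h, hx, hfg⟩ := exists_groupDet_dihedral_eq_resultant x
  obtain ⟨h2, hm2, h256⟩ := even_eval_of_symmetric hfg
  rw [hx] at hd ⊢
  clear hx
  obtain ⟨a, m, hmodd, hn⟩ := Nat.exists_eq_two_pow_mul_odd (NeZero.ne n)
  obtain ⟨k, hk⟩ := hmodd
  have hm0 : m ≠ 0 := by omega
  have hpar2 : (2 : ℤ) ∣ h.eval 2 - h.eval 0 := by simpa using sub_dvd_eval_sub 2 0 h
  have hparm2 : (2 : ℤ) ∣ h.eval (-2) - h.eval 0 := by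
    have := sub_dvd_eval_sub (-2) 0 h
    rwa [sub_zero, neg_dvd] at this
  have hdm : ((2 : ℕ) : ℤ) ∣ (Chebyshev.C ℤ (m : ℤ) - 2).resultant h := by
    exact prime_dvd_resultant_of_pow_mul (p := 2) hm0 a (by rw [← hn]; exact_mod_cast hd)
  have hdm' := hdm
  rw [hk, resultant_chebyshevC_odd_sub_two, Nat.cast_ofNat] at hdm'
  -- The integers `h(0)`, `h(2)`, `h(-2)` have equal parity. Evenness thus comes either from all
  -- three rational values or from the resultant with `V`, and hence with `W` and `U`.
  have hcase : 2 ∣ h.eval 0 ∨ ¬ 2 ∣ h.eval 0 ∧ 2 ∣ (chebyshevV k).resultant h := by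
    by_cases h0 : 2 ∣ h.eval 0
    · exact .inl h0
    · refine .inr ⟨h0, ?_⟩
      rcases Int.prime_two.dvd_or_dvd hdm' with h | h
      · omega
      · exact Int.prime_two.dvd_of_dvd_pow h
  have hdvd (c : ℕ) (hc : c ∣ n / m) : (Chebyshev.C ℤ ((c * m : ℕ) : ℤ) - 2).resultant h ∣
      (Chebyshev.C ℤ (n : ℤ) - 2).resultant h := by
    have hnm : n = n / m * m := (Nat.div_mul_cancel ⟨2 ^ a, by rw [hn, mul_comm]⟩).symm
    obtain ⟨j, hj⟩ := hc
    have hn0 : n = j * (c * m) := by rw [← mul_assoc, mul_comm j, ← hj, ← hnm]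
    have : j * (c * m) ≠ 0 := hn0 ▸ NeZero.ne n
    conv_rhs => rw [hn0]
    exact resultant_chebyshevC_sub_two_dvd (right_ne_zero_of_mul this) (left_ne_zero_of_mul this) h
  have hquot (c : ℕ) (hcop : c.Coprime m) (hc : c ∣ n) : c ∣ n / m := by
    have : n / m = 2 ^ a := by rw [hn, Nat.mul_div_cancel _ (by omega)]
    rw [this]
    exact hcop.dvd_of_dvd_mul_right (hn ▸ hc)
  have hsq {t : ℤ} (ht : 2 ∣ t) : 4 ∣ t ^ 2 := by
    simpa using pow_dvd_pow_of_dvd ht 2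
  refine ⟨?_, fun hn2 => ?_, fun hn4 => ?_⟩
  · refine dvd_trans ?_ (hdvd 1 (one_dvd _))
    rw [one_mul, hk, resultant_chebyshevC_odd_sub_two]
    rcases hcase with h0 | ⟨-, hV⟩
    · exact (h2 (by omega)).mul_right _
    · exact (hsq hV).mul_left _
  · refine dvd_trans ?_ (hdvd 2 (hquot 2 (by rw [Nat.coprime_two_left]; exact ⟨k, hk⟩) hn2))
    rw [resultant_chebyshevC_two_mul_sub_two hm0, hk, resultant_chebyshevC_odd_sub_two,
      resultant_chebyshevC_odd_add_two]
    rw [show (16 : ℤ) = 4 * 4 by norm_num]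
    rcases hcase with h0 | ⟨-, hV⟩
    · exact mul_dvd_mul ((h2 (by omega)).mul_right _) ((hm2 (by omega)).mul_right _)
    · exact mul_dvd_mul ((hsq hV).mul_left _)
        ((hsq ((two_dvd_resultant_chebyshevW_iff k h).mpr hV)).mul_left _)
  · refine dvd_trans ?_ (hdvd 4 (hquot 4 ?_ hn4))
    · rw [resultant_chebyshevC_four_mul_sub_two hm0, hk, resultant_chebyshevC_odd_sub_two,
        resultant_chebyshevC_odd_add_two, resultant_chebyshevC_odd]
      rcases hcase with h0 | ⟨h0, hV⟩
      · refine ((h256 h0).mul_right (((chebyshevV k).resultant h * (chebyshevW k).resultant h *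
          (chebyshevOddCofactor k).resultant h) ^ 2)).trans (dvd_of_eq ?_)
        ring
      · have h16 := pow_dvd_pow_of_dvd (sixteen_dvd_resultants h0 hV) 2
        refine ((by norm_num : (16 : ℤ) ^ 2 = 256) ▸ h16.mul_right
          (h.eval 2 * h.eval (-2) * h.eval 0 ^ 2)).trans (dvd_of_eq ?_)
        ring
    · rw [show 4 = 2 ^ 2 by norm_num]
      exact (Nat.coprime_two_left.mpr ⟨k, hk⟩).pow_left 2

theorem dvd_groupDet_dihedral_of_odd_prime {n : ℕ} [NeZero n] (x : DihedralGroup n → ℤ) {p : ℕ}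
    (hp : p.Prime) (hp2 : p ≠ 2) {a : ℕ} (ha : p ^ a ∣ n) (hd : (p : ℤ) ∣ groupDet x) :
    (p : ℤ) ^ (2 * a + 1) ∣ groupDet x := by
  obtain ⟨f, g, h, hx, -⟩ := exists_groupDet_dihedral_eq_resultant x
  obtain ⟨m, hm⟩ := ha
  have hm0 : m ≠ 0 := by rintro rfl; exact NeZero.ne n hm
  have hn : groupDet x = (Chebyshev.C ℤ ((p ^ a * m : ℕ) : ℤ) - 2).resultant h := by rw [hx, ← hm]
  rw [hn] at hd ⊢
  exact odd_prime_pow_dvd_resultant hp hp2 hm0 a hd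

end DivisibilityOfDeterminants

/-! ### Constructions attaining the listed values -/

section AttainedValues

open Polynomial

theorem mem_nontrivialDetValues_of_norm {n : ℕ} [NeZero n] (f g : ℤ[X]) {v : ℕ} (hv : 2 ≤ v)
    (h : ∏ z ∈ nthRootsFinset n (1 : ℂ), ‖aeval z f * aeval z⁻¹ f - aeval z g * aeval z⁻¹ g‖ = v) :
    v ∈ nontrivialDetValues (DihedralGroup n) := by
  obtain ⟨x, hx⟩ := exists_groupDet_dihedral_eq n f g
  refine ⟨hv, x, ?_⟩
  have := congrArg norm hx
  rw [norm_prod, h, Complex.norm_intCast] at this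
  rw [← Nat.cast_inj (R := ℝ), Nat.cast_natAbs, Int.cast_abs]
  exact this

theorem norm_eq_one_of_mem_nthRoots {n : ℕ} [NeZero n] {z : ℂ} (hz : z ∈ nthRootsFinset n (1 : ℂ)) :
    ‖z‖ = 1 :=
  Complex.norm_eq_one_of_pow_eq_one ((mem_nthRootsFinset (NeZero.pos n) 1).mp hz) (NeZero.ne n)

theorem prod_norm_sub_nthRoots {n : ℕ} [NeZero n] (c : ℂ) :
    ∏ z ∈ nthRootsFinset n (1 : ℂ), ‖c - z‖ = ‖c ^ n - 1‖ := by
  rw [← norm_prod, prod_sub_nthRoots (NeZero.pos n)]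

/-- The exponent `j` occurs `k+1-|j|` times in the first product and `k-|j|` times in the second, so
the difference is the sum of `z^j` over `|j| ≤ k`. -/
theorem geom_sum_symmetric {z : ℂ} (hz : z ≠ 0) (k : ℕ) :
    (∑ i ∈ Finset.range (k + 1), z ^ i) * (∑ i ∈ Finset.range (k + 1), z⁻¹ ^ i) -
      (∑ i ∈ Finset.range k, z ^ i) * (∑ i ∈ Finset.range k, z⁻¹ ^ i) =
      z⁻¹ ^ k * ∑ i ∈ Finset.range (2 * k + 1), z ^ i := by
  have hk (k : ℕ) : z ^ k * z⁻¹ ^ k = 1 := by rw [← mul_pow, mul_inv_cancel₀ hz, one_pow]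
  have hrefl : z ^ k * ∑ i ∈ Finset.range k, z⁻¹ ^ i = z * ∑ i ∈ Finset.range k, z ^ i := by
    induction k with
    | zero => simp
    | succ k ih =>
      rw [Finset.sum_range_succ, Finset.sum_range_succ, pow_succ]
      linear_combination z * ih + z * hk k + z * geom_sum_mul z k
  have hsplit : ∑ i ∈ Finset.range (2 * k + 1), z ^ i = (∑ i ∈ Finset.range k, z ^ i) +
      z ^ k * (1 + z * ∑ i ∈ Finset.range k, z ^ i) := by
    rw [show 2 * k + 1 = k + (k + 1) by ring, Finset.sum_range_add, Finset.sum_range_succ',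
      Finset.mul_sum, mul_add, Finset.mul_sum]
    simp only [pow_add]
    ring_nf
  rw [hsplit, Finset.sum_range_succ, Finset.sum_range_succ]
  linear_combination hrefl - (z * ∑ i ∈ Finset.range k, z ^ i) * hk k

/-- The factor at `z = 1` is `v`; the others are `(z^v - 1)/(z - 1)`, and `z ↦ z^v` permutes the
nontrivial `n`-th roots of unity. -/
theorem prod_norm_geom_sum {n : ℕ} [NeZero n] {v : ℕ} (hv : v.Coprime n) :
    ∏ z ∈ nthRootsFinset n (1 : ℂ), ‖∑ i ∈ Finset.range v, z ^ i‖ = v := by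
  classical
  have h1 : (1 : ℂ) ∈ nthRootsFinset n (1 : ℂ) := by
    rw [mem_nthRootsFinset (NeZero.pos n), one_pow]
  rw [← Finset.mul_prod_erase _ _ h1]
  have hne : ∏ z ∈ (nthRootsFinset n (1 : ℂ)).erase 1, ‖z - 1‖ ≠ 0 :=
    Finset.prod_ne_zero_iff.mpr fun z hz => norm_ne_zero_iff.mpr
      (sub_ne_zero.mpr (Finset.ne_of_mem_erase hz))
  have hinj : Set.InjOn (fun z : ℂ => z ^ v) (nthRootsFinset n (1 : ℂ) : Set ℂ) := by
    intro y hy z hz hyz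
    rw [Finset.mem_coe, mem_nthRootsFinset (NeZero.pos n)] at hy hz
    have hz0 : z ≠ 0 := by rintro rfl; simp [NeZero.ne n] at hz
    have := pow_gcd_eq_one.mpr
      ⟨show (y / z) ^ v = 1 by
        rw [div_pow, show y ^ v = z ^ v from hyz, div_self (pow_ne_zero _ hz0)],
        show (y / z) ^ n = 1 by rw [div_pow, hy, hz, div_one]⟩
    rw [hv.gcd_eq_one, pow_one, div_eq_one_iff_eq hz0] at this
    exact this
  have hmaps : Set.MapsTo (fun z : ℂ => z ^ v) ((nthRootsFinset n (1 : ℂ)).erase 1)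
      ((nthRootsFinset n (1 : ℂ)).erase 1) := by
    intro z hz
    rw [Finset.mem_coe, Finset.mem_erase] at hz ⊢
    refine ⟨fun h => hz.1 (hinj hz.2 h1 (by simpa using h)), ?_⟩
    rw [mem_nthRootsFinset (NeZero.pos n)] at hz ⊢
    rw [← pow_mul, mul_comm, pow_mul, hz.2, one_pow]
  have hinj' : Set.InjOn (fun z : ℂ => z ^ v) ((nthRootsFinset n (1 : ℂ)).erase 1 : Finset ℂ) :=
    hinj.mono (Finset.coe_subset.mpr (Finset.erase_subset _ _))
  have hperm : ∏ z ∈ (nthRootsFinset n (1 : ℂ)).erase 1, ‖z ^ v - 1‖ =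
      ∏ z ∈ (nthRootsFinset n (1 : ℂ)).erase 1, ‖z - 1‖ :=
    Finset.prod_nbij (fun z => z ^ v) hmaps hinj'
      (Finset.surjOn_of_injOn_of_card_le _ hmaps hinj' le_rfl) fun _ _ => rfl
  have hone : ∏ z ∈ (nthRootsFinset n (1 : ℂ)).erase 1, ‖∑ i ∈ Finset.range v, z ^ i‖ = 1 := by
    refine mul_right_cancel₀ hne ?_
    rw [one_mul, ← Finset.prod_mul_distrib, ← hperm]
    refine Finset.prod_congr rfl fun z _ => ?_
    rw [← norm_mul, geom_sum_mul]
  rw [hone]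
  simp

theorem odd_coprime_mem {n : ℕ} [NeZero n] {v : ℕ} (hv : 2 ≤ v) (hodd : Odd v)
    (hcop : v.Coprime n) : v ∈ nontrivialDetValues (DihedralGroup n) := by
  obtain ⟨k, rfl⟩ := hodd
  refine mem_nontrivialDetValues_of_norm (∑ i ∈ Finset.range (k + 1), X ^ i)
    (∑ i ∈ Finset.range k, X ^ i) hv ?_
  rw [← prod_norm_geom_sum hcop]
  refine Finset.prod_congr rfl fun z hz => ?_
  have hz1 := norm_eq_one_of_mem_nthRoots hz
  simp only [map_sum, map_pow, aeval_X]
  rw [geom_sum_symmetric (by rintro rfl; simp at hz1), norm_mul, norm_pow, norm_inv, hz1]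
  simp

theorem sq_mem_of_prod_norm {n : ℕ} [NeZero n] (f : ℤ[X]) {w : ℕ} (hw : 2 ≤ w)
    (h : ∏ z ∈ nthRootsFinset n (1 : ℂ), ‖aeval z f‖ = w) :
    w ^ 2 ∈ nontrivialDetValues (DihedralGroup n) := by
  refine mem_nontrivialDetValues_of_norm f 0 (hw.trans (Nat.le_self_pow two_ne_zero w)) ?_
  simp only [map_zero, mul_zero, sub_zero, norm_mul, Finset.prod_mul_distrib]
  rw [prod_nthRoots_inv (NeZero.pos n) fun z => ‖aeval z f‖, h]
  push_cast
  ring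

theorem four_mem {n : ℕ} [NeZero n] (hn : Odd n) : 4 ∈ nontrivialDetValues (DihedralGroup n) := by
  refine sq_mem_of_prod_norm (1 + X) le_rfl (w := 2) ?_
  have h := prod_norm_sub_nthRoots (n := n) (-1)
  rw [hn.neg_one_pow, show ‖(-1 - 1 : ℂ)‖ = 2 by norm_num] at h
  rw [Nat.cast_ofNat, ← h]
  refine Finset.prod_congr rfl fun z _ => ?_
  rw [← norm_neg]
  simp
  ring_nf

/-- `1 + z² = (i - z)(-i - z)`, and `(±i)^n = -1`, so each linear factor contributes `2`. -/
theorem sixteen_mem {n : ℕ} [NeZero n] {m : ℕ} (hn : n = 2 * m) (hm : Odd m) :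
    16 ∈ nontrivialDetValues (DihedralGroup n) := by
  refine sq_mem_of_prod_norm (1 + X ^ 2) (by norm_num) (w := 4) ?_
  have h1 := prod_norm_sub_nthRoots (n := n) Complex.I
  have h2 := prod_norm_sub_nthRoots (n := n) (-Complex.I)
  have hI : Complex.I ^ n = -1 := by rw [hn, pow_mul, Complex.I_sq, hm.neg_one_pow]
  have hnI : (-Complex.I) ^ n = -1 := by rw [hn, pow_mul, neg_sq, Complex.I_sq, hm.neg_one_pow]
  rw [hI, show ‖(-1 - 1 : ℂ)‖ = 2 by norm_num] at h1
  rw [hnI, show ‖(-1 - 1 : ℂ)‖ = 2 by norm_num] at h2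
  have h4 : ((4 : ℕ) : ℝ) = (∏ z ∈ nthRootsFinset n (1 : ℂ), ‖Complex.I - z‖) *
      ∏ z ∈ nthRootsFinset n (1 : ℂ), ‖-Complex.I - z‖ := by
    rw [h1, h2]; norm_num
  rw [h4, ← Finset.prod_mul_distrib]
  refine Finset.prod_congr rfl fun z _ => ?_
  rw [← norm_mul]
  congr 1
  simp only [map_add, map_one, map_pow, aeval_X]
  linear_combination Complex.I_sq

/-- Up to the unit `z³`, the factor `1 + z³ + z⁻³` is `(ξ³ - z³)(ξ⁶ - z³)` with `ξ` a primitive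
ninth root of unity. As `ξ³` is an `n`-th root of unity, the product is the cube of `|(y - 1)(y² -
1)| = 3`, where `y = ξ^n` is a primitive cube root of unity. -/
theorem twentyseven_mem {n : ℕ} [NeZero n] {m : ℕ} (hn : n = 3 * m) (hm : ¬ 3 ∣ m) :
    27 ∈ nontrivialDetValues (DihedralGroup n) := by
  obtain ⟨ξ, hξ⟩ : ∃ ξ : ℂ, ξ ^ 6 + ξ ^ 3 + 1 = 0 := by
    obtain ⟨ξ, hξ⟩ := IsAlgClosed.exists_root (X ^ 6 + X ^ 3 + 1 : ℂ[X]) (by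
      rw [show (X ^ 6 + X ^ 3 + 1 : ℂ[X]).degree = 6 by compute_degree!]
      norm_num)
    exact ⟨ξ, by simpa using hξ⟩
  obtain ⟨w, rfl⟩ : ∃ w, w = ξ ^ 3 := ⟨_, rfl⟩
  have hw3 : (ξ ^ 3) ^ 3 = 1 := by linear_combination (ξ ^ 3 - 1) * hξ
  have hwn : (ξ ^ 3) ^ n = 1 := by rw [hn, pow_mul, hw3, one_pow]
  have hy : (ξ ^ n) ^ 2 + ξ ^ n + 1 = 0 := by
    rw [hn, pow_mul]
    have hdiv := Nat.div_add_mod m 3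
    have hpos : m % 3 ≠ 0 := fun h => hm (Nat.dvd_of_mod_eq_zero h)
    have hlt := Nat.mod_lt m three_pos
    rw [← hdiv, pow_add, pow_mul, hw3, one_pow, one_mul]
    rcases (by omega : m % 3 = 1 ∨ m % 3 = 2) with h | h <;> rw [h]
    · linear_combination hξ
    · linear_combination hξ + ξ ^ 3 * hw3
  have hfac (c z : ℂ) : c ^ 3 - z ^ 3 = (c - z) * (c * ξ ^ 3 - z) * (c * (ξ ^ 3) ^ 2 - z) := by
    linear_combination (-c ^ 3) * hw3 + (c ^ 2 * z * ξ ^ 3 - c * z ^ 2) * hξ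
  have hcube (c : ℂ) : ∏ z ∈ nthRootsFinset n (1 : ℂ), ‖c ^ 3 - z ^ 3‖ = ‖c ^ n - 1‖ ^ 3 := by
    simp only [hfac, norm_mul, Finset.prod_mul_distrib, prod_norm_sub_nthRoots]
    rw [mul_pow, mul_pow, hwn, ← pow_mul, mul_comm 2 n, pow_mul _ n, hwn]
    simp only [one_pow, mul_one]
    ring
  refine mem_nontrivialDetValues_of_norm (1 + X ^ 3) 1 (by norm_num) ?_
  have h1 := hcube ξ
  have h2 := hcube (ξ ^ 2)
  have h27 : ‖ξ ^ n - 1‖ ^ 3 * ‖(ξ ^ 2) ^ n - 1‖ ^ 3 = 27 := by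
    rw [← mul_pow, ← norm_mul, ← pow_mul, mul_comm 2 n, pow_mul,
      show (ξ ^ n - 1) * ((ξ ^ n) ^ 2 - 1) = 3 by linear_combination (ξ ^ n - 2) * hy]
    norm_num
  rw [Nat.cast_ofNat, ← h27, ← h1, ← h2, ← Finset.prod_mul_distrib]
  refine Finset.prod_congr rfl fun z hz => ?_
  have hz1 := norm_eq_one_of_mem_nthRoots hz
  have hz0 : z ≠ 0 := by rintro rfl; simp at hz1
  have hval : (ξ ^ 3 - z ^ 3) * ((ξ ^ 2) ^ 3 - z ^ 3) = z ^ 3 *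
      ((1 + z ^ 3) * (1 + z⁻¹ ^ 3) - 1) := by
    have hinv : z ^ 3 * z⁻¹ ^ 3 = 1 := by rw [← mul_pow, mul_inv_cancel₀ hz0, one_pow]
    linear_combination (-z ^ 3) * hξ + hw3 - (1 + z ^ 3) * hinv
  rw [← norm_mul, hval, norm_mul, norm_pow, hz1]
  simp

end AttainedValues

/-! ### Minimality and exhaustiveness of the table -/

section LowerBound

theorem odd_prime_pow_dvd_of_mem {n : ℕ} [NeZero n] {u : ℕ}
    (hu : u ∈ nontrivialDetValues (DihedralGroup n)) {p : ℕ} (hp : p.Prime) (hp2 : p ≠ 2) {a : ℕ}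
    (ha : p ^ a ∣ n) (hd : p ∣ u) : p ^ (2 * a + 1) ∣ u := by
  obtain ⟨-, x, rfl⟩ := hu
  have := dvd_groupDet_dihedral_of_odd_prime x hp hp2 ha (Int.natCast_dvd.mpr hd)
  exact Int.natCast_dvd.mp (by exact_mod_cast this)

theorem two_pow_dvd_of_mem {n : ℕ} [NeZero n] {u : ℕ}
    (hu : u ∈ nontrivialDetValues (DihedralGroup n)) (hd : 2 ∣ u) :
    4 ∣ u ∧ (2 ∣ n → 16 ∣ u) ∧ (4 ∣ n → 256 ∣ u) := by
  obtain ⟨-, x, rfl⟩ := hu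
  have := dvd_groupDet_dihedral_of_even x (Int.natCast_dvd.mpr hd)
  exact ⟨Int.natCast_dvd.mp this.1, fun h => Int.natCast_dvd.mp (this.2.1 h),
    fun h => Int.natCast_dvd.mp (this.2.2 h)⟩

theorem lindLehmer_dihedral_eq {n : ℕ} [NeZero n] {v : ℕ}
    (hmem : v ∈ nontrivialDetValues (DihedralGroup n))
    (htwo : 2 < v → v ≤ 4 ∨ 2 ∣ n ∧ v ≤ 16 ∨ 4 ∣ n ∧ v ≤ 256)
    (hodd : ∀ q, q.Prime → q ≠ 2 → q < v → ∃ a, q ^ a ∣ n ∧ v ≤ q ^ (2 * a + 1)) :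
    lindLehmer (DihedralGroup n) = v := by
  refine (lindLehmer_isLeast _).unique ⟨hmem, fun u hu => ?_⟩
  have hu2 : 2 ≤ u := hu.1
  have hq : u.minFac.Prime := Nat.minFac_prime (by omega)
  have hqu : u.minFac ∣ u := Nat.minFac_dvd u
  rcases lt_or_ge u.minFac v with hlt | hge
  · by_cases h2 : u.minFac = 2
    · rw [h2] at hqu hlt
      obtain ⟨h4, h16, h256⟩ := two_pow_dvd_of_mem hu hqu
      have hpos : 0 < u := by omega
      rcases htwo hlt with h | ⟨hn, h⟩ | ⟨hn, h⟩
      · exact h.trans (Nat.le_of_dvd hpos h4)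
      · exact h.trans (Nat.le_of_dvd hpos (h16 hn))
      · exact h.trans (Nat.le_of_dvd hpos (h256 hn))
    · obtain ⟨a, ha, hv⟩ := hodd _ hq h2 hlt
      exact hv.trans (Nat.le_of_dvd (by omega) (odd_prime_pow_dvd_of_mem hu hq h2 ha hqu))
  · exact hge.trans (Nat.le_of_dvd (by omega) hqu)

theorem prime_mem {n : ℕ} [NeZero n] {v : ℕ} (hv : v.Prime) (hv2 : v ≠ 2) (hn : ¬ v ∣ n) :
    v ∈ nontrivialDetValues (DihedralGroup n) :=
  odd_coprime_mem hv.two_le (hv.odd_of_ne_two hv2) ((Nat.Prime.coprime_iff_not_dvd hv).mpr hn)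

theorem not_dvd_mul_of_coprime {v c m n : ℕ} (hn : n = c * m) (hc : v.Coprime c) (hm : ¬ v ∣ m) :
    ¬ v ∣ n := by
  rwa [hn, hc.dvd_mul_left]

theorem exists_pow_dvd_of_dvd {v q n : ℕ} (hq : q.Prime) (hq2 : q ≠ 2) (hd : q ∣ n) (hv : v ≤ 27) :
    ∃ a, q ^ a ∣ n ∧ v ≤ q ^ (2 * a + 1) := by
  refine ⟨1, by rwa [pow_one], hv.trans ?_⟩
  have h3 : 3 ≤ q := by have := hq.two_le; omega
  exact Nat.pow_le_pow_left h3 3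

/-- The exponent is `2` for `q = 3`, giving `3⁵ = 243`, and `1` otherwise, giving at least `5³ =
125`. This limit explains the end of the table: `113` is the largest prime below `125`. -/
theorem exists_pow_dvd_of_nine_dvd {v q n : ℕ} (hq : q.Prime) (hq2 : q ≠ 2) (hd : q ∣ n)
    (h9 : 9 ∣ n) (hv : v ≤ 125) : ∃ a, q ^ a ∣ n ∧ v ≤ q ^ (2 * a + 1) := by
  rcases eq_or_ne q 3 with rfl | h3
  · exact ⟨2, h9, hv.trans (by norm_num)⟩
  · refine ⟨1, by rwa [pow_one], hv.trans ?_⟩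
    have h4 : q ≠ 4 := by rintro rfl; norm_num at hq
    have h5 : 5 ≤ q := by have := hq.two_le; omega
    exact Nat.pow_le_pow_left h5 3

theorem dvd_primeProd {q k : ℕ} (hq : q.Prime) (h5 : 5 ≤ q) (hk : q < k) : q ∣ primeProd k :=
  Finset.dvd_prod_of_mem _ (Finset.mem_filter.mpr ⟨Finset.mem_Ico.mpr ⟨h5, hk⟩, hq⟩)

theorem coprime_primeProd {v k : ℕ} (hv : v.Prime) (hk : k ≤ v) : v.Coprime (primeProd k) := by
  refine Nat.Coprime.prod_right fun q hq => ?_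
  rw [Finset.mem_filter, Finset.mem_Ico] at hq
  rw [Nat.coprime_primes hv hq.2]
  omega

theorem lindLehmer_dihedral_of_prime {n : ℕ} [NeZero n] {v c m : ℕ} (hv : v.Prime) (hv2 : v ≠ 2)
    (hn : n = c * m) (hc : v.Coprime c) (hm : ¬ v ∣ m) (hv27 : v ≤ 27)
    (htwo : 2 ∣ c ∧ v ≤ 16 ∨ 4 ∣ c) (hodd : ∀ q < v, q.Prime → q ≠ 2 → q ∣ c) :
    lindLehmer (DihedralGroup n) = v := by
  have hcn : c ∣ n := ⟨m, hn⟩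
  refine lindLehmer_dihedral_eq (prime_mem hv hv2 (not_dvd_mul_of_coprime hn hc hm)) (fun _ => .inr ?_)
    fun q hq h2 hlt => exists_pow_dvd_of_dvd hq h2 ((hodd q hlt hq h2).trans hcn) hv27
  rcases htwo with ⟨h, h16⟩ | h
  · exact .inl ⟨h.trans hcn, h16⟩
  · exact .inr ⟨h.trans hcn, by omega⟩

theorem lindLehmer_dihedral_of_large_prime {n : ℕ} [NeZero n] {v c m : ℕ} (hv : v.Prime)
    (hv2 : v ≠ 2) (hn : n = c * m) (hc : v.Coprime c) (hm : ¬ v ∣ m) (hv125 : v ≤ 125)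
    (h4 : 4 ∣ c) (h9 : 9 ∣ c) (hodd : ∀ q < v, q.Prime → q ≠ 2 → q ∣ c) :
    lindLehmer (DihedralGroup n) = v := by
  have hcn : c ∣ n := ⟨m, hn⟩
  exact lindLehmer_dihedral_eq (prime_mem hv hv2 (not_dvd_mul_of_coprime hn hc hm))
    (fun _ => .inr (.inr ⟨h4.trans hcn, by omega⟩)) fun q hq h2 hlt =>
      exists_pow_dvd_of_nine_dvd hq h2 ((hodd q hlt hq h2).trans hcn) (h9.trans hcn) hv125

theorem lindLehmer_dihedral_of_case {n : ℕ} [NeZero n] {v : ℕ} (h : DihedralCase n v) :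
    lindLehmer (DihedralGroup n) = v := by
  rcases h with ⟨rfl, h⟩ | ⟨rfl, m, hn, h⟩ | ⟨rfl, m, hn, h⟩ | ⟨rfl, m, hn, h⟩ | ⟨rfl, m, hn, h⟩ |
    ⟨rfl, m, hn, h⟩ | ⟨rfl, m, hn, h⟩ | ⟨rfl, m, hn, h⟩ | ⟨rfl, m, hn, h⟩ | ⟨rfl, m, hn, h⟩ |
    ⟨rfl, m, hn, h⟩ | ⟨rfl, m, hn, h⟩ | ⟨hv, hv1, hv2, m, hn, h⟩
  · exact lindLehmer_dihedral_eq (prime_mem Nat.prime_three (by norm_num) h)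
      (fun _ => .inl (by norm_num))
      (fun q hq h2 hlt => by have := hq.two_le; omega)
  · refine lindLehmer_dihedral_eq (four_mem ?_) (fun _ => .inl le_rfl) fun q hq h2 hlt => ⟨1, ?_⟩
    · rw [← Nat.not_even_iff_odd, even_iff_two_dvd, hn, Nat.Coprime.dvd_mul_left (by norm_num)]
      exact h
    · obtain rfl : q = 3 := by have := hq.two_le; omega
      exact ⟨⟨m, hn⟩, by norm_num⟩
  · exact lindLehmer_dihedral_of_prime (by norm_num) (by norm_num) hn (by norm_num) h (by norm_num)
      (by norm_num) (by decide)
  · exact lindLehmer_dihedral_of_prime (by norm_num) (by norm_num) hn (by norm_num) h (by norm_num)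
      (by norm_num) (by decide)
  · exact lindLehmer_dihedral_of_prime (by norm_num) (by norm_num) hn (by norm_num) h (by norm_num)
      (by norm_num) (by decide)
  · exact lindLehmer_dihedral_of_prime (by norm_num) (by norm_num) hn (by norm_num) h (by norm_num)
      (by norm_num) (by decide)
  · have hcn : 2 * 3 * 5 * 7 * 11 * 13 ∣ n := ⟨m, hn⟩
    refine lindLehmer_dihedral_eq (sixteen_mem (m := 3 * 5 * 7 * 11 * 13 * m) (by rw [hn]; ring) ?_)
      (fun _ => .inr (.inl ⟨(by norm_num : 2 ∣ 2 * 3 * 5 * 7 * 11 * 13).trans hcn, le_rfl⟩))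
      fun q hq h2 hlt => exists_pow_dvd_of_dvd hq h2 (dvd_trans ?_ hcn) (by norm_num)
    · rw [← Nat.not_even_iff_odd, even_iff_two_dvd, Nat.Coprime.dvd_mul_left (by norm_num)]
      exact h
    · exact (by decide : ∀ q < 16, q.Prime → q ≠ 2 → q ∣ 2 * 3 * 5 * 7 * 11 * 13) q hlt hq h2
  · exact lindLehmer_dihedral_of_prime (by norm_num) (by norm_num) hn (by norm_num) h (by norm_num)
      (by norm_num) (by decide)
  · exact lindLehmer_dihedral_of_prime (by norm_num) (by norm_num) hn (by norm_num) h (by norm_num)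
      (by norm_num) (by decide)
  · exact lindLehmer_dihedral_of_prime (by norm_num) (by norm_num) hn (by norm_num) h (by norm_num)
      (by norm_num) (by decide)
  · have hcn : 2 ^ 2 * 3 * 5 * 7 * 11 * 13 * 17 * 19 * 23 ∣ n := ⟨m, hn⟩
    refine lindLehmer_dihedral_eq
      (twentyseven_mem (m := 2 ^ 2 * 5 * 7 * 11 * 13 * 17 * 19 * 23 * m) (by rw [hn]; ring) ?_)
      (fun _ => .inr (.inr ⟨dvd_trans (by norm_num) hcn, by norm_num⟩))
      fun q hq h2 hlt => exists_pow_dvd_of_dvd hq h2 (dvd_trans ?_ hcn) le_rfl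
    · rw [Nat.Coprime.dvd_mul_left (by norm_num)]
      exact h
    · exact (by decide : ∀ q < 27, q.Prime → q ≠ 2 →
        q ∣ 2 ^ 2 * 3 * 5 * 7 * 11 * 13 * 17 * 19 * 23) q hlt hq h2
  · exact lindLehmer_dihedral_of_large_prime (by norm_num) (by norm_num) hn (by norm_num) h
      (by norm_num) (by norm_num) (by norm_num) (by decide)
  · have hcop (p : ℕ) (hp : p.Prime) (hpv : p < v) : v.Coprime p :=
      (Nat.coprime_primes hv hp).mpr hpv.ne'
    refine lindLehmer_dihedral_of_large_prime hv (by omega) hn ?_ h (by omega) ?_ ?_ ?_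
    · exact (((hcop 2 Nat.prime_two (by omega)).pow_right 2).mul_right
        ((hcop 3 Nat.prime_three (by omega)).pow_right 2)).mul_right (coprime_primeProd hv le_rfl)
    · exact Dvd.dvd.mul_right (by norm_num) _
    · exact Dvd.dvd.mul_right (by norm_num) _
    · intro q hlt hq h2
      rcases eq_or_ne q 3 with rfl | h3
      · exact Dvd.dvd.mul_right (by norm_num) _
      · have h4 : q ≠ 4 := by rintro rfl; norm_num at hq
        exact (dvd_primeProd hq (by have := hq.two_le; omega) hlt).mul_left _

theorem primeProd_succ {k : ℕ} (hk : 5 ≤ k) :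
    primeProd (k + 1) = if k.Prime then primeProd k * k else primeProd k := by
  rw [primeProd, primeProd, Finset.prod_filter, Finset.prod_filter, Finset.prod_Ico_succ_top hk]
  split_ifs <;> simp

theorem primeProd_thirty : primeProd 30 = 5 * 7 * 11 * 13 * 17 * 19 * 23 * 29 := by
  have h5 : primeProd 5 = 1 := by simp [primeProd]
  norm_num [primeProd_succ, h5]

/-- The failure of each case puts one more prime into the known divisor of `n`, and that divisor is
the one required by the next case. -/
theorem exists_dihedralCase {n : ℕ} (hn : ¬ 2 ^ 2 * 3 ^ 2 * primeProd 114 ∣ n) :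
    ∃ v, DihedralCase n v := by
  by_contra! hno
  simp only [DihedralCase] at hno
  have step {c p : ℕ} (hc : c ∣ n) (hp : ∀ m, n = c * m → p ∣ m) : c * p ∣ n := by
    obtain ⟨m, rfl⟩ := hc
    exact mul_dvd_mul_left c (hp m rfl)
  have h1 : 3 ∣ n := by
    by_contra h; exact hno 3 (.inl ⟨rfl, h⟩)
  have h2 := step (p := 2) h1 fun m hm => by
    by_contra h; exact hno 4 (.inr (.inl ⟨rfl, m, hm, h⟩))
  rw [mul_comm] at h2
  have h3 := step (p := 5) h2 fun m hm => by
    by_contra h; exact hno 5 (.inr (.inr (.inl ⟨rfl, m, hm, h⟩)))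
  have h4 := step (p := 7) h3 fun m hm => by
    by_contra h; exact hno 7 (.inr (.inr (.inr (.inl ⟨rfl, m, hm, h⟩))))
  have h5 := step (p := 11) h4 fun m hm => by
    by_contra h; exact hno 11 (.inr (.inr (.inr (.inr (.inl ⟨rfl, m, hm, h⟩)))))
  have h6 := step (p := 13) h5 fun m hm => by
    by_contra h; exact hno 13 (.inr (.inr (.inr (.inr (.inr (.inl ⟨rfl, m, hm, h⟩))))))
  have h7 := step (p := 2) h6 fun m hm => by
    by_contra h; exact hno 16 (.inr (.inr (.inr (.inr (.inr (.inr (.inl ⟨rfl, m, hm, h⟩)))))))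
  rw [show 2 * 3 * 5 * 7 * 11 * 13 * 2 = 2 ^ 2 * 3 * 5 * 7 * 11 * 13 by norm_num] at h7
  have h8 := step (p := 17) h7 fun m hm => by
    by_contra h
    exact hno 17 (.inr (.inr (.inr (.inr (.inr (.inr (.inr (.inl ⟨rfl, m, hm, h⟩))))))))
  have h9 := step (p := 19) h8 fun m hm => by
    by_contra h
    exact hno 19 (.inr (.inr (.inr (.inr (.inr (.inr (.inr (.inr (.inl ⟨rfl, m, hm, h⟩)))))))))
  have h10 := step (p := 23) h9 fun m hm => by
    by_contra h
    exact hno 23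
      (.inr (.inr (.inr (.inr (.inr (.inr (.inr (.inr (.inr (.inl ⟨rfl, m, hm, h⟩))))))))))
  have h11 := step (p := 3) h10 fun m hm => by
    by_contra h
    exact hno 27
      (.inr (.inr (.inr (.inr (.inr (.inr (.inr (.inr (.inr (.inr (.inl ⟨rfl, m, hm, h⟩)))))))))))
  rw [show 2 ^ 2 * 3 * 5 * 7 * 11 * 13 * 17 * 19 * 23 * 3 =
    2 ^ 2 * 3 ^ 2 * 5 * 7 * 11 * 13 * 17 * 19 * 23 by norm_num] at h11
  have h12 := step (p := 29) h11 fun m hm => by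
    by_contra h
    exact hno 29 (.inr (.inr (.inr (.inr (.inr (.inr (.inr (.inr (.inr (.inr (.inr
      (.inl ⟨rfl, m, hm, h⟩))))))))))))
  have main (k : ℕ) (hk : k ≤ 84) : 2 ^ 2 * 3 ^ 2 * primeProd (30 + k) ∣ n := by
    induction k with
    | zero =>
      rw [add_zero, primeProd_thirty]
      simpa only [mul_assoc] using h12
    | succ k ih =>
      have hd := ih (by omega)
      rw [← add_assoc, primeProd_succ (by omega)]
      split_ifs with hp
      · rw [← mul_assoc]
        refine step hd fun m hm => ?_
        -- A prime `30 + k` is at least `31`, as the last case of the table demands.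
        have h30 : 30 + k ≠ 30 := fun h => by rw [h] at hp; norm_num at hp
        by_contra h
        refine hno (30 + k) (.inr (.inr (.inr (.inr (.inr (.inr (.inr (.inr (.inr (.inr (.inr (.inr
          ⟨hp, by omega, by omega, m, hm, h⟩))))))))))))
      · exact hd
  exact hn (main 84 le_rfl)

end LowerBound

theorem theorem1 (n : ℕ) [NeZero n] :
    (∀ v : ℕ, DihedralCase n v → lindLehmer (DihedralGroup n) = v) ∧
    (¬ 2 ^ 2 * 3 ^ 2 * primeProd 114 ∣ n → ∃ v : ℕ, DihedralCase n v) :=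
  ⟨fun _ => lindLehmer_dihedral_of_case, exists_dihedralCase⟩
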